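/- Let $G=G_1\times\cdots\times G_n$ be a $\sigma$-compact group that is the product of locally compact (Hausdorff) groups $G_1,\dots,G_n$, and let $\Gamma<G$ be a lattice, i.e. a discrete subgroup such that $G/\Gamma$ carries a $G$-invariant Radon probability measure $\mu$. Assume: (a) $\Gamma$ is irreducible: the projection of $\Gamma$ to each factor $G_i$ is dense in $G_i$; (b) $\Gamma$ is weakly cocompact: the representation $\varrho$ of $G$ by left translations on $L^2_0(G/\Gamma,\mu)$, the orthogonal complement of the constants in the real Hilbert space $L^2(G/\Gamma,\mu)$, does not almost have non-zero invariant vectors, i.e. it is not the case that $\inf_{\|v\|=1}\operatorname{diam}(\varrho(K)v)=0$ for every compact set $K\subseteq G$ (with $\inf\varnothing=+\infty$); (c) $\Gamma$ is $p$-integrable for some real $p>1$: either (i) $G/\Gamma$ is compact, or (ii) $\Gamma$ has a finite generating set $S$, with word length $\|\cdot\|_S$, and there is a Borel fundamental domain $\mathcal D\subseteq G$ for $\Gamma$ (a Borel set meeting every coset $g\Gamma$ in exactly one point) whose boundary is null for the Haar measure, such that $$\int_{\mathcal D}\|\chi(g^{-1}h)\|_S^p\,dh<\infty\qquad\text{for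 all } g\in G,$$ where $dh$ is a left Haar measure and $\chi:G\to\Gamma$ is the map defined by $\chi^{-1}(e)=\mathcal D$ and $\chi(g\gamma^{-1})=\gamma\chi(g)$ for $g\in G$, $\gamma\in\Gamma$. Then every group homomorphism $\varphi:\Gamma\to\mathbf R$ extends continuously to $G$: there is a continuous group homomorphism $\psi:G\to\mathbf R$ with $\psi|_\Gamma=\varphi$. -/

import Mathlib

open MeasureTheory
open scoped ENNReal Topology

noncomputable section

namespace LatticeCharacters

section Representations

variable {G : Type*} [Group G] [TopologicalSpace G]
  {B : Type*} [NormedAddCommGroup B] [NormedSpace ℝ B]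

/-- A linear isometric representation `ρ` of a topological group `G` on `B` *almost has (non-zero)
invariant vectors* if `inf_{‖v‖ = 1} diam (ρ(K) v) = 0` for every compact `K ⊆ G`
(the infimum over the empty set being `+∞`). -/
def AlmostHasInvariantVectors (ρ : G →* (B ≃ₗᵢ[ℝ] B)) : Prop :=
  ∀ K : Set G, IsCompact K → ∀ ε : ℝ, 0 < ε →
    ∃ v : B, ‖v‖ = 1 ∧ Metric.diam ((fun g => ρ g v) '' K) < ε

end Representations

section QuasiRegular

variable {G : Type*} [Group G] {X : Type*} [MulAction G X] [MeasurableSpace X]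
  [MeasurableConstSMul G X] (μ : Measure X) [SMulInvariantMeasure G X μ]

/-- The representation of `G` on the real Hilbert space `L²(X, μ)` associated with a
measure-preserving action: `(ρ(g) f)(x) = f(g⁻¹ x)`. -/
def quasiRegular : G →* (Lp ℝ 2 μ ≃ₗᵢ[ℝ] Lp ℝ 2 μ) where
  toFun g :=
    { toFun := fun f => Lp.compMeasurePreserving (fun x : X => g⁻¹ • x)
        (measurePreserving_smul g⁻¹ μ) f
      invFun := fun f => Lp.compMeasurePreserving (fun x : X => g • x)
        (measurePreserving_smul g μ) f
      map_add' := fun f₁ f₂ => map_add _ f₁ f₂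
      map_smul' := fun c f => by
        exact map_smul (Lp.compMeasurePreservingₗ ℝ (fun x : X => g⁻¹ • x)
          (measurePreserving_smul g⁻¹ μ)) c f
      left_inv := fun f => by
        change DomMulAct.mk g • (DomMulAct.mk g⁻¹ • f) = f
        rw [smul_smul, ← DomMulAct.mk_mul]; simp
      right_inv := fun f => by
        change DomMulAct.mk g⁻¹ • (DomMulAct.mk g • f) = f
        rw [smul_smul, ← DomMulAct.mk_mul]; simp
      norm_map' := fun f => Lp.norm_compMeasurePreserving f (measurePreserving_smul g⁻¹ μ) }
  map_one' := by
    ext1 f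
    change DomMulAct.mk (1 : G)⁻¹ • f = f
    simp
  map_mul' g h := by
    ext1 f
    change DomMulAct.mk (g * h)⁻¹ • f = DomMulAct.mk g⁻¹ • (DomMulAct.mk h⁻¹ • f)
    rw [smul_smul, ← DomMulAct.mk_mul, mul_inv_rev]

variable [IsFiniteMeasure μ]

/-- `L²₀(X, μ)`: the orthogonal complement of the constant functions in `L²(X, μ)`. -/
def L20 : Submodule ℝ (Lp ℝ 2 μ) :=
  (LinearMap.range (Lp.constₗ (E := ℝ) 2 μ ℝ))ᗮ

lemma quasiRegular_mem_L20 (g : G) {f : Lp ℝ 2 μ} (hf : f ∈ L20 μ) :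
    quasiRegular μ g f ∈ L20 μ := by
  rw [L20, Submodule.mem_orthogonal] at hf ⊢
  rintro _ ⟨c, rfl⟩
  have h : quasiRegular μ g (Lp.constₗ (E := ℝ) 2 μ ℝ c) = Lp.constₗ (E := ℝ) 2 μ ℝ c :=
    DomMulAct.smul_Lp_const (DomMulAct.mk g⁻¹) c
  rw [← h, LinearIsometryEquiv.inner_map_map]
  exact hf _ ⟨c, rfl⟩

/-- The representation of `G` on `L²₀(X, μ)`, the restriction of the one on `L²(X, μ)`. -/
def quasiRegularZero : G →* (L20 μ ≃ₗᵢ[ℝ] L20 μ) where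
  toFun g :=
    { toFun := fun f => ⟨quasiRegular μ g f, quasiRegular_mem_L20 μ g f.2⟩
      invFun := fun f => ⟨quasiRegular μ g⁻¹ f, quasiRegular_mem_L20 μ g⁻¹ f.2⟩
      map_add' := fun f₁ f₂ => Subtype.ext (map_add (quasiRegular μ g) f₁.1 f₂.1)
      map_smul' := fun c f => Subtype.ext (map_smul (quasiRegular μ g) c f.1)
      left_inv := fun f => Subtype.ext (by simp)
      right_inv := fun f => Subtype.ext (by simp)
      norm_map' := fun f => (quasiRegular μ g).norm_map f.1 }
  map_one' := by
    ext1 f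
    exact Subtype.ext (by simp)
  map_mul' g h := by
    ext1 f
    exact Subtype.ext (by simp)

end QuasiRegular

section Lattices

variable {G : Type*} [Group G] [TopologicalSpace G] [IsTopologicalGroup G]

/-- The Borel σ-algebra on the coset space `G / Γ`. -/
abbrev cosetBorel (Γ : Subgroup G) : MeasurableSpace (G ⧸ Γ) := borel (G ⧸ Γ)

attribute [local instance] cosetBorel

lemma cosetBorelSpace {G : Type*} [Group G] [TopologicalSpace G] (Γ : Subgroup G) :
    BorelSpace (G ⧸ Γ) := ⟨rfl⟩

attribute [local instance] cosetBorelSpace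

/-- `μ` is a `G`-invariant Radon probability measure on the Borel sets of `G / Γ`. -/
structure IsInvariantProbability (Γ : Subgroup G) (μ : Measure (G ⧸ Γ)) : Prop where
  prob : IsProbabilityMeasure μ
  regular : μ.Regular
  invariant : SMulInvariantMeasure G (G ⧸ Γ) μ

/-- A lattice: a discrete subgroup of finite invariant covolume. -/
structure IsLattice (Γ : Subgroup G) : Prop where
  discrete : DiscreteTopology Γ
  finite_covolume : ∃ μ : Measure (G ⧸ Γ), IsInvariantProbability Γ μ

/-- `Γ` is weakly cocompact: for the (unique) invariant Radon probability measure `μ` of `G / Γ`,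
the `G`-representation on `L²₀(G / Γ, μ)` does not almost have non-zero invariant vectors. -/
def IsWeaklyCocompact (Γ : Subgroup G) : Prop :=
  ∃ (μ : Measure (G ⧸ Γ)) (h : IsInvariantProbability Γ μ),
    haveI := h.prob
    haveI := h.invariant
    ¬ AlmostHasInvariantVectors (quasiRegularZero (G := G) μ)

/-- The word length of `x` with respect to `S`: the least length of a word in `S ∪ S⁻¹`
representing `x` (used only when `S` generates). -/
def wordLength {Λ : Type*} [Group Λ] (S : Set Λ) (x : Λ) : ℕ :=
  sInf {k | ∃ l : List Λ, l.length = k ∧ (∀ s ∈ l, s ∈ S ∨ s⁻¹ ∈ S) ∧ l.prod = x}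

/-- A Borel set `D` meeting every coset `g Γ` in exactly one point. -/
structure IsBorelFundamentalDomain (Γ : Subgroup G) (D : Set G) : Prop where
  borel : MeasurableSet[borel G] D
  existsUnique : ∀ g : G, ∃! γ : Γ, g * (γ : G) ∈ D

/-- `Γ` is `p`-integrable: either `G / Γ` is compact, or `Γ` has a finite generating set `S` and a
Borel fundamental domain `D` with null boundary, such that `∫_D ‖χ(g⁻¹ h)‖_S ^ p dh < ∞` for all
`g`, where `χ : G → Γ` is given by `χ⁻¹(1) = D` and `χ(g γ⁻¹) = γ χ(g)`. -/
def IsPIntegrable [LocallyCompactSpace G] (Γ : Subgroup G) (p : ℝ) : Prop :=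
  letI : MeasurableSpace G := borel G
  haveI : BorelSpace G := ⟨rfl⟩
  CompactSpace (G ⧸ Γ) ∨
    ∃ S : Set Γ, S.Finite ∧ Subgroup.closure S = ⊤ ∧
      ∃ (D : Set G) (χ : G → Γ), IsBorelFundamentalDomain Γ D ∧
        (Measure.haar : Measure G) (frontier D) = 0 ∧
        χ ⁻¹' {1} = D ∧ (∀ (g : G) (γ : Γ), χ (g * (γ : G)⁻¹) = γ * χ g) ∧
        ∀ g : G, ∫⁻ h in D, (wordLength S (χ (g⁻¹ * h)) : ℝ≥0∞) ^ p ∂Measure.haar < ∞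

/-- A subgroup of a product is irreducible if its projection to every factor is dense. -/
def IsIrreducible {n : ℕ} {H : Fin n → Type*} [∀ i, Group (H i)] [∀ i, TopologicalSpace (H i)]
    (Γ : Subgroup (∀ i, H i)) : Prop :=
  ∀ i, Dense ((fun x : ∀ j, H j => x i) '' (Γ : Set (∀ j, H j)))

end Lattices

end LatticeCharacters

end

set_option linter.unusedSectionVars false

/-! Write $G=\prod H_i$, $X=G/\Gamma$ and $h=\varphi\circ\chi$, so that
$h(x\gamma)=h(x)-\varphi(\gamma)$. The differences $h(g^{-1}y)-h(y)$ are right $\Gamma$-invariant in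
$y$ and define a cocycle $b$ of $G$ in functions on $X$. By $p$-integrability, $b$ is continuous
into $L^1(X)$ with $p$-th moments bounded on compact sets (`exists_induced_cocycle`). Suppose
$b(g)=\psi(g)+v-gv$ with $\psi(g)=\int b(g)$. Then $\psi$ is a continuous homomorphism, the function
$h(y)+v(y\Gamma)+\psi(y)$ is left invariant, hence a.e. constant, and comparing it at $y$ and
$y\gamma$ gives $\psi|_\Gamma=\varphi$.

It remains to show that the centred cocycle $b_0=b-\int b$ is a coboundary
(`exists_eq_const_add_sub_translate`), i.e. that the affine action $v\mapsto gv+b_0(g)$ has a fixed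
point. Averaging over each factor $H_i$ against a suitable probability measure $m_i$ gives commuting
affine maps $v\mapsto P_iv+c_i$. Absence of almost invariant vectors makes the mean $Q$ of the $P_i$
a strict contraction of $L^2_0$ (`exists_norm_meanOperator_le`). The cocycle lives only in $L^1$,
but truncation at a height depending on $k$ shows that $Q^k$ decays exponentially on centred
functions with finite $p$-th moment (`norm_meanOperator_pow_centered_le`). Hence $\sum_k Q^kd$, with
$d$ the mean of the $c_i$, converges to a common fixed point $v$ (`exists_common_fixedPoint`).

For $g\in H_i$ the defect $u=gv+b_0(g)-v$ is fixed by $P_j$ for $j\ne i$, hence by all of $H_j$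
(`factorTranslate_eq_of_factorAverage_eq`). Irreducibility makes $\prod_{j\ne i}H_j$ ergodic on $X$
(`exists_eq_const_of_translate_eq`), so $u$ is constant; its mean is zero, so $u=0$. -/

noncomputable section

namespace LatticeCharacters

/-! ### Translation operators on $L^q$. -/

section Translation

variable {G : Type*} [Group G] {X : Type*} [MulAction G X] [MeasurableSpace X]
  [MeasurableConstSMul G X] (μ : Measure X) [SMulInvariantMeasure G X μ]
  (q : ℝ≥0∞) [Fact (1 ≤ q)]

/-- The action of `g` on `L^q(X, μ)` by left translations, `f ↦ f (g⁻¹ • ·)`. -/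
def translate (g : G) : Lp ℝ q μ →L[ℝ] Lp ℝ q μ :=
  (Lp.compMeasurePreservingₗᵢ ℝ (fun x : X => g⁻¹ • x)
    (measurePreserving_smul g⁻¹ μ)).toContinuousLinearMap

variable {μ q}

lemma translate_ae_eq (g : G) (f : Lp ℝ q μ) :
    translate μ q g f =ᵐ[μ] fun x => f (g⁻¹ • x) :=
  Lp.coeFn_compMeasurePreserving f (measurePreserving_smul g⁻¹ μ)

lemma norm_translate (g : G) (f : Lp ℝ q μ) : ‖translate μ q g f‖ = ‖f‖ :=
  Lp.norm_compMeasurePreserving f (measurePreserving_smul g⁻¹ μ)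

lemma translate_one (f : Lp ℝ q μ) : translate μ q (1 : G) f = f := by
  change DomMulAct.mk (1 : G)⁻¹ • f = f
  simp

lemma translate_mul (g h : G) (f : Lp ℝ q μ) :
    translate μ q (g * h) f = translate μ q g (translate μ q h f) := by
  change DomMulAct.mk (g * h)⁻¹ • f = DomMulAct.mk g⁻¹ • (DomMulAct.mk h⁻¹ • f)
  rw [smul_smul, ← DomMulAct.mk_mul, mul_inv_rev]

lemma translate_const [IsFiniteMeasure μ] (g : G) (c : ℝ) :
    translate μ q g (Lp.const q μ c) = Lp.const q μ c :=
  DomMulAct.smul_Lp_const (DomMulAct.mk g⁻¹) c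

lemma integral_translate (g : G) (f : Lp ℝ q μ) : ∫ x, translate μ q g f x ∂μ = ∫ x, f x ∂μ := by
  rw [integral_congr_ae (translate_ae_eq g f)]
  exact (measurePreserving_smul g⁻¹ μ).integral_comp
    (measurableEmbedding_const_smul g⁻¹) (fun x => f x)

lemma continuous_translate [TopologicalSpace G] [IsTopologicalGroup G] [TopologicalSpace X]
    [BorelSpace X] [R1Space X] [ContinuousSMul G X] [μ.InnerRegularCompactLTTop]
    [IsLocallyFiniteMeasure μ] (hq : q ≠ ∞) (f : Lp ℝ q μ) :
    Continuous fun g : G => translate μ q g f := by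
  let c : C(G, C(X, X)) :=
    (ContinuousMap.mk (fun a : G × X => a.1⁻¹ • a.2) (by fun_prop)).curry
  exact (continuous_const (y := f)).compMeasurePreservingLp c.continuous
    (fun g => measurePreserving_smul g⁻¹ μ) hq

end Translation

/-! ### Averages of strongly continuous families of contractions. -/

section Average

variable {A : Type*} [TopologicalSpace A] [MeasurableSpace A] [BorelSpace A] [SigmaCompactSpace A]
  {V : Type*} [NormedAddCommGroup V]

/-- The range is a countable union of compact sets, hence separable. This gives Bochner
measurability without second countability of the group. -/
lemma stronglyMeasurable_of_continuous_sigmaCompact {f : A → V} (hf : Continuous f) :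
    StronglyMeasurable f := by
  borelize V
  refine stronglyMeasurable_iff_measurable_separable.2 ⟨hf.measurable, ?_⟩
  have : Set.range f = ⋃ n, f '' compactCovering A n := by
    rw [← Set.image_iUnion, iUnion_compactCovering, Set.image_univ]
  rw [this, TopologicalSpace.isSeparable_iUnion]
  exact fun n => ((isCompact_compactCovering A n).image hf).isSeparable

variable [NormedSpace ℝ V]

/-- A strongly continuous family of linear contractions. -/
structure IsContractionFamily (ρ : A → V →L[ℝ] V) : Prop where
  norm_le : ∀ a v, ‖ρ a v‖ ≤ ‖v‖
  continuous : ∀ v, Continuous fun a => ρ a v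

variable {ρ : A → V →L[ℝ] V} (hρ : IsContractionFamily ρ) (m : Measure A)
include hρ

lemma IsContractionFamily.integrable [IsFiniteMeasure m] (v : V) :
    Integrable (fun a => ρ a v) m :=
  (integrable_const ‖v‖).mono'
    (stronglyMeasurable_of_continuous_sigmaCompact (hρ.continuous v)).aestronglyMeasurable
    (ae_of_all _ fun a => hρ.norm_le a v)

/-- The average of a family of contractions with respect to a probability measure. -/
def IsContractionFamily.average [IsProbabilityMeasure m] : V →L[ℝ] V :=
  LinearMap.mkContinuous
    { toFun := fun v => ∫ a, ρ a v ∂m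
      map_add' := fun v w => by
        simp only [map_add]
        exact integral_add (hρ.integrable m v) (hρ.integrable m w)
      map_smul' := fun c v => by
        simp only [map_smul, RingHom.id_apply]
        exact integral_smul c _ } 1 fun v => by
    refine (norm_integral_le_of_norm_le (integrable_const ‖v‖)
      (ae_of_all _ fun a => hρ.norm_le a v)).trans ?_
    simp

lemma IsContractionFamily.average_apply [IsProbabilityMeasure m] (v : V) :
    hρ.average m v = ∫ a, ρ a v ∂m := rfl

lemma IsContractionFamily.norm_average_le [IsProbabilityMeasure m] (v : V) :
    ‖hρ.average m v‖ ≤ ‖v‖ := by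
  refine (norm_integral_le_of_norm_le (integrable_const ‖v‖)
      (ae_of_all _ fun a => hρ.norm_le a v)).trans ?_
  simp

/-- A continuous linear map intertwining two families intertwines the averages. -/
lemma IsContractionFamily.map_average [CompleteSpace V] {W : Type*} [NormedAddCommGroup W]
    [NormedSpace ℝ W] [CompleteSpace W] {τ : A → W →L[ℝ] W} (hτ : IsContractionFamily τ)
    [IsProbabilityMeasure m] (T : V →L[ℝ] W) (h : ∀ a v, T (ρ a v) = τ a (T v)) (v : V) :
    T (hρ.average m v) = hτ.average m (T v) := by
  rw [hρ.average_apply, ← T.integral_comp_comm (hρ.integrable m v), hτ.average_apply]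
  simp only [h]

end Average

/-! ### The inclusion of $L^2$ in $L^1$, and mean-zero functions. -/

section Inclusion

variable {X : Type*} [MeasurableSpace X] (μ : Measure X) [IsProbabilityMeasure μ]

/-- The inclusion of `L²` in `L¹` over a probability space. -/
def inclusionL2L1 : Lp ℝ 2 μ →L[ℝ] Lp ℝ 1 μ :=
  LinearMap.mkContinuous
    { toFun := fun f => ((Lp.memLp f).mono_exponent (p := 1) (by norm_num)).toLp f
      map_add' := fun f g => by
        rw [← MemLp.toLp_add]
        exact MemLp.toLp_congr _ _ (Lp.coeFn_add f g)
      map_smul' := fun c f => by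
        rw [RingHom.id_apply, ← MemLp.toLp_const_smul]
        exact MemLp.toLp_congr _ _ (Lp.coeFn_smul c f) } 1 fun f => by
    rw [one_mul]
    change ‖((Lp.memLp f).mono_exponent (p := 1) (by norm_num)).toLp f‖ ≤ ‖f‖
    rw [Lp.norm_toLp, Lp.norm_def]
    exact ENNReal.toReal_mono (Lp.eLpNorm_ne_top f)
      (eLpNorm_le_eLpNorm_of_exponent_le (by norm_num) (Lp.aestronglyMeasurable f))

variable {μ}

lemma inclusionL2L1_ae_eq (f : Lp ℝ 2 μ) : inclusionL2L1 μ f =ᵐ[μ] f :=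
  MemLp.coeFn_toLp ((Lp.memLp f).mono_exponent (p := 1) (by norm_num))

lemma norm_inclusionL2L1_le (f : Lp ℝ 2 μ) : ‖inclusionL2L1 μ f‖ ≤ ‖f‖ := by
  rw [Lp.norm_def, Lp.norm_def, eLpNorm_congr_ae (inclusionL2L1_ae_eq f)]
  exact ENNReal.toReal_mono (Lp.eLpNorm_ne_top f)
      (eLpNorm_le_eLpNorm_of_exponent_le (by norm_num) (Lp.aestronglyMeasurable f))

lemma inclusionL2L1_translate {G : Type*} [Group G] [MulAction G X] [MeasurableConstSMul G X]
    [SMulInvariantMeasure G X μ] (g : G) (f : Lp ℝ 2 μ) :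
    inclusionL2L1 μ (translate μ 2 g f) = translate μ 1 g (inclusionL2L1 μ f) := by
  apply Lp.ext
  refine (inclusionL2L1_ae_eq _).trans ((translate_ae_eq g f).trans ?_)
  refine Filter.EventuallyEq.symm ((translate_ae_eq g _).trans ?_)
  exact (measurePreserving_smul g⁻¹ μ).quasiMeasurePreserving.ae_eq_comp (inclusionL2L1_ae_eq f)

lemma integral_inclusionL2L1 (f : Lp ℝ 2 μ) : ∫ x, inclusionL2L1 μ f x ∂μ = ∫ x, f x ∂μ :=
  integral_congr_ae (inclusionL2L1_ae_eq f)

lemma inclusionL2L1_const (c : ℝ) : inclusionL2L1 μ (Lp.const 2 μ c) = Lp.const 1 μ c := by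
  apply Lp.ext
  exact (inclusionL2L1_ae_eq _).trans ((Lp.coeFn_const 2 μ c).trans (Lp.coeFn_const 1 μ c).symm)

lemma mem_L20_iff (f : Lp ℝ 2 μ) : f ∈ L20 μ ↔ ∫ x, f x ∂μ = 0 := by
  have key : ∀ c : ℝ, inner ℝ (Lp.constₗ (E := ℝ) 2 μ ℝ c) f = c * ∫ x, f x ∂μ := fun c => by
    rw [L2.inner_def, ← integral_const_mul]
    refine integral_congr_ae ?_
    filter_upwards [Lp.coeFn_const 2 μ c] with x hx
    have : (Lp.constₗ (E := ℝ) 2 μ ℝ c) x = c := hx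
    rw [this]
    simp [mul_comm]
  rw [L20, Submodule.mem_orthogonal]
  constructor
  · intro h
    have := h _ ⟨1, rfl⟩
    rwa [key, one_mul] at this
  · rintro h _ ⟨c, rfl⟩
    rw [key, h, mul_zero]

end Inclusion

section

open scoped Pointwise

/-! ### The variance of an orbit in Hilbert space. -/

section HilbertAverage

variable {A : Type*} [TopologicalSpace A] [MeasurableSpace A] [BorelSpace A] [SigmaCompactSpace A]
  {V : Type*} [NormedAddCommGroup V] [InnerProductSpace ℝ V] [CompleteSpace V] {ρ : A → V →L[ℝ] V}

/-- Expand the square: $\|\rho_av\|=\|v\|$, and the mean of $\langle w,\rho_av\rangle$ is $\|w\|^2$.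
A vector whose norm barely drops under averaging thus has an orbit concentrated near its mean. -/
lemma integral_norm_sub_average_sq (hρ : IsContractionFamily ρ) (hiso : ∀ a v, ‖ρ a v‖ = ‖v‖)
    (m : Measure A) [IsProbabilityMeasure m] (v : V) :
    Integrable (fun a => ‖ρ a v - hρ.average m v‖ ^ 2) m ∧
    ∫ a, ‖ρ a v - hρ.average m v‖ ^ 2 ∂m = ‖v‖ ^ 2 - ‖hρ.average m v‖ ^ 2 := by
  set w := hρ.average m v with hw
  have hi : Integrable (fun a => inner ℝ w (ρ a v)) m := (hρ.integrable m v).const_inner w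
  have hin : ∫ a, inner ℝ w (ρ a v) ∂m = ‖w‖ ^ 2 := by
    rw [integral_inner (hρ.integrable m v), ← hρ.average_apply, ← hw, real_inner_self_eq_norm_sq]
  have hfun : (fun a => ‖ρ a v - w‖ ^ 2)
      = fun a => (‖v‖ ^ 2 + ‖w‖ ^ 2) - 2 * inner ℝ w (ρ a v) := by
    funext a
    rw [norm_sub_sq_real, hiso, real_inner_comm]
    ring
  rw [hfun]
  refine ⟨(integrable_const _).sub (hi.const_mul 2), ?_⟩
  rw [integral_sub (integrable_const _) (hi.const_mul 2), integral_const_mul, hin]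
  simp
  ring

end HilbertAverage

/-! ### Spread measures: from near-invariance under averaging to near-invariance under the group. -/

section Spread

variable {A : Type*} [Group A] [TopologicalSpace A] [IsTopologicalGroup A] [LocallyCompactSpace A]
  [T2Space A]   [MeasurableSpace A] [BorelSpace A]

/-- A measure with a large atom at the identity which, on compact sets, dominates a multiple of
Haar measure. -/
structure IsSpread (m : Measure A) : Prop where
  half_le : 1 / 2 ≤ m {1}
  haar_le : ∀ C : Set A, IsCompact C → ∃ c : ℝ≥0∞, c ≠ 0 ∧
    ∀ E : Set A, MeasurableSet E → c * Measure.haar (E ∩ C) ≤ m E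

/-- Sum the restrictions of Haar measure to a compact exhaustion with geometric weights, damped so
that the total mass and the integral of $N$ are at most $1/2$; the missing mass becomes an atom at
the identity. In the application $N$ is the $p$-th moment of the cocycle. -/
lemma exists_isSpread [SigmaCompactSpace A] (N : A → ℝ≥0∞)
    (hN : ∀ C : Set A, IsCompact C → ∃ M : NNReal, ∀ a ∈ C, N a ≤ M) :
    ∃ m : Measure A, IsProbabilityMeasure m ∧ IsSpread m ∧ ∫⁻ a, N a ∂m < ∞ := by
  let K := CompactExhaustion.choice A
  choose M hM using fun n => hN (K n) (K.isCompact n)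
  let lam : Measure A := Measure.haar
  have hlam : ∀ n, lam (K n) ≠ ∞ := fun n => (K.isCompact n).measure_lt_top.ne
  let d : ℕ → ℝ≥0∞ := fun n => (1 + M n) * (1 + lam (K n))
  have hd : ∀ n, d n ≠ ∞ := fun n =>
    ENNReal.mul_ne_top (by simp) (ENNReal.add_ne_top.2 ⟨by simp, hlam n⟩)
  have hd1 : ∀ n, d n ≠ 0 := fun n => mul_ne_zero (by simp) (by simp)
  let a : ℕ → ℝ≥0∞ := fun n => 2⁻¹ * (2⁻¹ ^ (n + 1)) / d n
  have ha0 : ∀ n, a n ≠ 0 := fun n => ENNReal.div_ne_zero.2 ⟨by simp, hd n⟩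
  have had : ∀ n, a n * d n = 2⁻¹ * (2⁻¹ ^ (n + 1)) := fun n =>
    ENNReal.div_mul_cancel (hd1 n) (hd n)
  let m' : Measure A := Measure.sum fun n => a n • lam.restrict (K n)
  have hsum : ∑' n : ℕ, (2⁻¹ : ℝ≥0∞) * (2⁻¹ ^ (n + 1)) = 2⁻¹ := by
    rw [ENNReal.tsum_mul_left, ENNReal.tsum_geometric_add_one]
    simp [ENNReal.inv_mul_cancel]
  have hm' : m' Set.univ ≤ 2⁻¹ := by
    rw [Measure.sum_apply _ MeasurableSet.univ, ← hsum]
    refine ENNReal.tsum_le_tsum fun n => ?_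
    rw [← had n]
    simp only [Measure.smul_apply, Measure.restrict_apply_univ, smul_eq_mul]
    gcongr
    calc lam (K n) ≤ 1 * (1 + lam (K n)) := by simp
      _ ≤ d n := mul_le_mul_left (by simp) _
  have hNm' : ∫⁻ x, N x ∂m' ≤ 2⁻¹ := by
    rw [lintegral_sum_measure, ← hsum]
    refine ENNReal.tsum_le_tsum fun n => ?_
    rw [← had n, lintegral_smul_measure, smul_eq_mul]
    gcongr
    calc ∫⁻ x in K n, N x ∂lam ≤ ∫⁻ _ in K n, (M n : ℝ≥0∞) ∂lam :=
          setLIntegral_mono' (K.isCompact n).measurableSet (fun x hx => hM n x hx)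
      _ = M n * lam (K n) := by simp
      _ ≤ d n := mul_le_mul' (by simp) (by simp)
  let m : Measure A := m' + (1 - m' Set.univ) • Measure.dirac 1
  have h1 : m' Set.univ ≤ 1 := hm'.trans (by simp)
  refine ⟨m, ⟨?_⟩, ⟨?_, ?_⟩, ?_⟩
  · simp [m, add_tsub_cancel_of_le h1]
  · have h2 : (1 / 2 : ℝ≥0∞) ≤ 1 - m' Set.univ := by
      rw [one_div, ← ENNReal.one_sub_inv_two]
      exact tsub_le_tsub_left hm' 1
    refine h2.trans ?_
    simp only [m, Measure.add_apply, Measure.smul_apply, smul_eq_mul]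
    rw [Measure.dirac_apply_of_mem (Set.mem_singleton _), mul_one]
    exact le_add_self
  · intro C hC
    obtain ⟨n, hn⟩ := K.exists_superset_of_isCompact hC
    refine ⟨a n, ha0 n, fun E hE => ?_⟩
    calc a n * lam (E ∩ C) ≤ a n * lam (E ∩ K n) := by gcongr
      _ = (a n • lam.restrict (K n)) E := by
          simp [Measure.restrict_apply hE]
      _ ≤ m' E := Measure.le_sum (fun n => a n • lam.restrict (K n)) n E
      _ ≤ m E := by simp [m]
  · simp only [m, lintegral_add_measure, lintegral_smul_measure, lintegral_dirac]
    obtain ⟨M1, hM1⟩ := hN {1} isCompact_singleton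
    refine ENNReal.add_lt_top.2 ⟨hNm'.trans_lt (by simp), ?_⟩
    refine ENNReal.mul_lt_top (tsub_le_self.trans_lt (by simp)) ?_
    exact (hM1 1 rfl).trans_lt ENNReal.coe_lt_top

/-- A spread measure charges every nonempty open set. -/
lemma IsSpread.ae_eq_imp_eq {m : Measure A} (hm : IsSpread m) {Y : Type*} [TopologicalSpace Y]
    [T2Space Y] {f g : A → Y} (hf : Continuous f) (hg : Continuous g) (h : f =ᵐ[m] g) : f = g := by
  by_contra hne
  obtain ⟨a, ha⟩ := Function.ne_iff.1 hne
  have hopen : IsOpen {x | f x ≠ g x} := isOpen_ne_fun hf hg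
  obtain ⟨C, hC, haC, hCE⟩ := exists_compact_subset hopen (show a ∈ {x | f x ≠ g x} from ha)
  obtain ⟨c, hc, hcE⟩ := hm.haar_le C hC
  have h0 : m {x | f x ≠ g x} = 0 := h
  have h1 := hcE _ hopen.measurableSet
  rw [h0, Set.inter_eq_right.2 hCE] at h1
  have h2 : 0 < (Measure.haar : Measure A) C :=
    (isOpen_interior.measure_pos _ ⟨a, haC⟩).trans_le (measure_mono interior_subset)
  exact absurd h1 (not_le.2 (ENNReal.mul_pos hc h2.ne'))

variable [SigmaCompactSpace A] {V : Type*} [NormedAddCommGroup V] [InnerProductSpace ℝ V]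
  [CompleteSpace V] {ρ : A → V →L[ℝ] V}

/-- If averaging fixes $v$ the variance vanishes, so $\rho_av=v$ for almost every $a$, and for every
$a$ by continuity. -/
lemma IsSpread.eq_of_average_eq {m : Measure A} [IsProbabilityMeasure m] (hm : IsSpread m)
    (hρ : IsContractionFamily ρ) (hiso : ∀ a v, ‖ρ a v‖ = ‖v‖) {v : V}
    (hv : hρ.average m v = v) (a : A) : ρ a v = v := by
  obtain ⟨hi, h0⟩ := integral_norm_sub_average_sq hρ hiso m v
  rw [hv, sub_self, integral_eq_zero_iff_of_nonneg (fun a => by positivity) (by rwa [hv] at hi)]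
    at h0
  have : (fun a => ρ a v) =ᵐ[m] fun _ => v := by
    filter_upwards [h0] with b hb
    simpa [sub_eq_zero] using hb
  exact congrFun (hm.ae_eq_imp_eq (hρ.continuous v) continuous_const this) a

/-- Unit vectors that are nearly preserved by the average are uniformly nearly fixed on compact
sets. -/
lemma IsSpread.exists_displacement_le {m : Measure A} [IsProbabilityMeasure m] (hm : IsSpread m)
    (hρ : IsContractionFamily ρ) (hiso : ∀ a v, ‖ρ a v‖ = ‖v‖) (hone : ∀ v, ρ 1 v = v)
    (hmul : ∀ a b v, ρ (a * b) v = ρ a (ρ b v)) {C : Set A} (hC : IsCompact C) {η : ℝ}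
    (hη : 0 < η) : ∃ δ : ℝ, 0 < δ ∧ ∀ v : V, ‖v‖ = 1 → 1 - δ < ‖hρ.average m v‖ →
      ∀ k ∈ C, ‖ρ k v - v‖ ≤ 4 * η := by
  obtain ⟨U, hU, hU1⟩ := exists_compact_mem_nhds (1 : A)
  let lam : Measure A := Measure.haar
  obtain ⟨c, hc, hcE⟩ := hm.haar_le (C * U ∪ U) ((hC.mul hU).union hU)
  have hlU : 0 < lam U := Measure.measure_pos_of_mem_nhds _ hU1
  -- Two sets of $m$-mass below $t$ have total mass below $c\,\lambda(U)$, too little for them to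
  -- cover $U$ up to translation.
  set t : ℝ≥0∞ := c * lam U / 2 with ht
  have ht0 : t ≠ 0 := by
    simp only [ht, ne_eq, ENNReal.div_eq_zero_iff, mul_eq_zero, not_or]
    exact ⟨⟨hc, hlU.ne'⟩, by simp⟩
  obtain ⟨s, hs0, hst⟩ := ENNReal.lt_iff_exists_nnreal_btwn.1
    (show (0 : ℝ≥0∞) < min t (1 / 2) from lt_min (pos_iff_ne_zero.2 ht0) (by simp))
  have hs0' : (0 : ℝ) < s := by exact_mod_cast hs0
  -- The variance is $1-\|w\|^2\le 2(1-\|w\|)<2\delta=\eta^2s$, so Chebyshev bounds by $s$ the mass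
  -- of the set `E` where $\rho_av$ is $\eta$-far from $w$.
  refine ⟨η ^ 2 * s / 2, by positivity, fun v hv hδ k hk => ?_⟩
  set w := hρ.average m v with hw
  obtain ⟨hi, hint⟩ := integral_norm_sub_average_sq hρ hiso m v
  have hw1 : ‖w‖ ≤ 1 := hv ▸ hρ.norm_average_le m v
  have hle : ∫ a, ‖ρ a v - w‖ ^ 2 ∂m ≤ η ^ 2 * s := by
    rw [hint, hv]
    nlinarith [norm_nonneg w]
  let E : Set A := {a | η ≤ ‖ρ a v - w‖}
  have hEc : IsClosed E :=
    isClosed_le continuous_const ((hρ.continuous v).sub continuous_const).norm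
  have hEs : m E ≤ s := by
    have h1 := mul_meas_ge_le_integral_of_nonneg (μ := m)
      (f := fun a => ‖ρ a v - w‖ ^ 2) (ae_of_all _ fun a => by positivity) hi (η ^ 2)
    have h2 : {a | η ^ 2 ≤ ‖ρ a v - w‖ ^ 2} = E := by
      ext a
      exact pow_le_pow_iff_left₀ hη.le (norm_nonneg _) two_ne_zero
    rw [h2] at h1
    have h3 : m.real E ≤ s := le_of_mul_le_mul_left (h1.trans hle) (by positivity)
    rw [← ENNReal.ofReal_coe_nnreal, ← ENNReal.ofReal_toReal (measure_ne_top m E)]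
    exact ENNReal.ofReal_le_ofReal h3
  -- The atom at the identity is heavier than `E`, hence $v=\rho_1v$ is itself close to $w$.
  have h1E : (1 : A) ∉ E := fun h => by
    have h1 : m {1} ≤ m E := measure_mono (by simpa using h)
    have h2 := (hm.half_le.trans h1).trans hEs
    exact absurd (h2.trans_lt (hst.trans_le (min_le_right _ _))) (lt_irrefl _)
  have hEt : m E < t := hEs.trans_lt (hst.trans_le (min_le_left _ _))
  let E' : Set A := E ∩ (C * U ∪ U)
  -- Some $g\in U$ has both $g$ and $kg$ outside `E`. Intersecting with $CU\cup U$ is what allows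
  -- the comparison with Haar measure.
  have hnot : ¬ U ⊆ E' ∪ (fun g => k * g) ⁻¹' E' := fun hsub => by
    have h1 : lam U ≤ lam E' + lam E' := by
      refine (measure_mono hsub).trans ((measure_union_le _ _).trans ?_)
      rw [measure_preimage_mul]
    have h2 : c * lam U ≤ m E + m E := by
      calc c * lam U ≤ c * (lam E' + lam E') := by gcongr
        _ = c * lam E' + c * lam E' := mul_add _ _ _
        _ ≤ m E + m E := add_le_add (hcE E hEc.measurableSet) (hcE E hEc.measurableSet)
    have h3 : m E + m E < t + t := ENNReal.add_lt_add hEt hEt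
    rw [ht, ENNReal.add_halves] at h3
    exact absurd (h2.trans_lt h3) (lt_irrefl _)
  obtain ⟨g, hgU, hg⟩ := Set.not_subset.1 hnot
  have hgE : g ∉ E := fun h => hg (Or.inl ⟨h, Or.inr hgU⟩)
  have hkgE : k * g ∉ E := fun h => hg (Or.inr ⟨h, Or.inl (Set.mul_mem_mul hk hgU)⟩)
  have e1 : ‖v - w‖ < η := by simpa [E, hone] using h1E
  have e2 : ‖ρ g v - w‖ < η := by simpa [E] using hgE
  have e3 : ‖ρ k (ρ g v) - w‖ < η := by simpa [E, hmul] using hkgE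
  have e4 : ‖ρ k (ρ g v) - ρ k w‖ < η := by rwa [← map_sub, hiso]
  have e5 : ‖ρ k v - ρ k w‖ < η := by rwa [← map_sub, hiso]
  -- The chain $\rho_kv,\ \rho_kw,\ \rho_k\rho_gv,\ w,\ v$ has four links, each shorter than $\eta$.
  have : ρ k v - v = (ρ k v - ρ k w) - (ρ k (ρ g v) - ρ k w) + (ρ k (ρ g v) - w) - (v - w) := by
    abel
  rw [this]
  calc _ ≤ ‖ρ k v - ρ k w‖ + ‖ρ k (ρ g v) - ρ k w‖ + ‖ρ k (ρ g v) - w‖ + ‖v - w‖ :=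
        (norm_sub_le _ _).trans (add_le_add_left ((norm_add_le _ _).trans
          (add_le_add_left (norm_sub_le _ _) _)) _)
    _ ≤ 4 * η := by linarith

end Spread

end

/-! ### Common fixed points of commuting affine maps. -/

section FixedPoint

variable {ι : Type*} [Fintype ι] {V : Type*} [NormedAddCommGroup V] [NormedSpace ℝ V]

/-- The arithmetic mean of finitely many operators. -/
def meanOperator (P : ι → V →L[ℝ] V) : V →L[ℝ] V := (Fintype.card ι : ℝ)⁻¹ • ∑ i, P i

lemma meanOperator_apply (P : ι → V →L[ℝ] V) (v : V) :
    meanOperator P v = (Fintype.card ι : ℝ)⁻¹ • ∑ i, P i v := by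
  simp [meanOperator]

variable [Nonempty ι]

lemma norm_meanOperator_le {P : ι → V →L[ℝ] V} (hP : ∀ i v, ‖P i v‖ ≤ ‖v‖) (v : V) :
    ‖meanOperator P v‖ ≤ ‖v‖ := by
  rw [meanOperator_apply, norm_smul, norm_inv, RCLike.norm_natCast, inv_mul_le_iff₀ (by positivity)]
  calc _ ≤ ∑ i, ‖P i v‖ := norm_sum_le _ _
    _ ≤ ∑ _i : ι, ‖v‖ := Finset.sum_le_sum fun i _ => hP i v
    _ = _ := by simp

lemma norm_meanOperator_pow_le {P : ι → V →L[ℝ] V} (hP : ∀ i v, ‖P i v‖ ≤ ‖v‖) (k : ℕ) (v : V) :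
    ‖(meanOperator P ^ k) v‖ ≤ ‖v‖ := by
  induction k with
  | zero => simp
  | succ k ih =>
    rw [pow_succ', mul_apply_eq_comp]
    exact (norm_meanOperator_le hP _).trans ih

lemma meanOperator_map {W : Type*} [NormedAddCommGroup W] [NormedSpace ℝ W] {P : ι → V →L[ℝ] V}
    {Q : ι → W →L[ℝ] W} (T : V →L[ℝ] W) (h : ∀ i v, T (P i v) = Q i (T v)) (k : ℕ) (v : V) :
    T ((meanOperator P ^ k) v) = (meanOperator Q ^ k) (T v) := by
  induction k with
  | zero => simp
  | succ k ih =>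
    rw [pow_succ', mul_apply_eq_comp, pow_succ', mul_apply_eq_comp, ← ih,
      meanOperator_apply, meanOperator_apply, map_smul, map_sum]
    simp only [h]

/-- Commuting affine maps `v ↦ P i v + c i` whose mean contracts exponentially along the
translation parts have a common fixed point. -/
lemma exists_common_fixedPoint [CompleteSpace V] {P : ι → V →L[ℝ] V} {c : ι → V}
    (hP : ∀ i j v, P i (P j v) = P j (P i v)) (hc : ∀ i j, P i (c j) + c i = P j (c i) + c j)
    {C : ι → ℝ} {θ : ℝ} (hθ : 0 ≤ θ) (hθ1 : θ < 1)
    (hdecay : ∀ i k, ‖(meanOperator P ^ k) (c i)‖ ≤ C i * θ ^ k) :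
    ∃ v, ∀ i, P i v + c i = v := by
  have hn : (Fintype.card ι : ℝ) ≠ 0 := by positivity
  -- The limit sought is $\sum_kQ^kd$, the fixed point of the mean affine map $v\mapsto Qv+d$.
  set Q := meanOperator P with hQ
  set d : V := (Fintype.card ι : ℝ)⁻¹ • ∑ i, c i with hd
  have hs : ∀ i, Summable fun k => (Q ^ k) (c i) := fun i =>
    Summable.of_norm_bounded ((summable_geometric_of_lt_one hθ hθ1).mul_left (C i)) (hdecay i)
  have hsd : Summable fun k => (Q ^ k) d := by
    have : (fun k => (Q ^ k) d) = fun k => (Fintype.card ι : ℝ)⁻¹ • ∑ i, (Q ^ k) (c i) := by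
      funext k
      rw [hd, map_smul, map_sum]
    rw [this]
    exact (summable_sum fun i _ => hs i).const_smul _
  have hPQ : ∀ i v, P i (Q v) = Q (P i v) := fun i v => by
    rw [hQ, meanOperator_apply, meanOperator_apply, map_smul, map_sum]
    simp only [hP i]
  have hPQk : ∀ i k v, P i ((Q ^ k) v) = (Q ^ k) (P i v) := fun i k v => by
    induction k with
    | zero => simp
    | succ k ih => rw [pow_succ', mul_apply_eq_comp, hPQ, ih,
        mul_apply_eq_comp]
  -- This is the commutation relation `hc i j` averaged over $j$.
  have hcd : ∀ i, P i d = d + Q (c i) - c i := fun i => by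
    have h1 : P i d = (Fintype.card ι : ℝ)⁻¹ • ∑ j, P i (c j) := by rw [hd, map_smul, map_sum]
    have h2 : ∀ j, P i (c j) = P j (c i) + c j - c i := fun j => by rw [← hc i j]; abel
    rw [h1, Finset.sum_congr rfl fun j _ => h2 j, Finset.sum_sub_distrib, Finset.sum_add_distrib,
      smul_sub, smul_add, hQ, meanOperator_apply, hd]
    simp only [Finset.sum_const, Finset.card_univ]
    rw [← Nat.cast_smul_eq_nsmul ℝ, smul_smul, inv_mul_cancel₀ hn, one_smul]
    abel
  refine ⟨∑' k, (Q ^ k) d, fun i => ?_⟩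
  rw [ContinuousLinearMap.map_tsum _ hsd]
  have h3 : ∀ k, P i ((Q ^ k) d) = (Q ^ k) d + (Q ^ (k + 1)) (c i) - (Q ^ k) (c i) := fun k => by
    rw [hPQk, hcd, map_sub, map_add, pow_succ, mul_apply_eq_comp]
  have hs1 : Summable fun k => (Q ^ (k + 1)) (c i) :=
    (summable_nat_add_iff (f := fun k => (Q ^ k) (c i)) 1).2 (hs i)
  simp only [h3]
  -- The terms $Q^{k+1}c_i-Q^kc_i$ telescope to $-c_i$, which cancels the translation part.
  rw [(hsd.add hs1).tsum_sub (hs i), hsd.tsum_add hs1, (hs i).tsum_eq_zero_add]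
  simp

end FixedPoint

/-! ### Averages over the factors and the spectral gap on $L^2_0$. -/

section ProductAction

variable {ι : Type*} [Fintype ι] [DecidableEq ι] {H : ι → Type*} [∀ i, Group (H i)]
  {X : Type*} [MulAction (∀ i, H i) X] [MeasurableSpace X]
  [MeasurableConstSMul (∀ i, H i) X] {μ : Measure X} [SMulInvariantMeasure (∀ i, H i) X μ]
  {q : ℝ≥0∞} [Fact (1 ≤ q)]

/-- Coordinates are switched on one at a time; translations being isometric, each costs at most $s$.
-/
lemma norm_translate_sub_le {f : Lp ℝ q μ} {x : ∀ i, H i} {s : ℝ}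
    (h : ∀ i, ‖translate μ q (Pi.mulSingle i (x i)) f - f‖ ≤ s) :
    ‖translate μ q x f - f‖ ≤ Fintype.card ι * s := by
  have key : ∀ S : Finset ι,
      ‖translate μ q (fun i => if i ∈ S then x i else 1) f - f‖ ≤ S.card * s := by
    intro S
    induction S using Finset.induction_on with
    | empty =>
      have : (fun i => if i ∈ (∅ : Finset ι) then x i else 1) = 1 := by
        funext i; simp
      rw [this, translate_one]
      simp
    | insert i S hi ih =>
      have : (fun j => if j ∈ insert i S then x j else 1)
          = Pi.mulSingle i (x i) * fun j => if j ∈ S then x j else 1 := by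
        funext j
        by_cases hj : j = i
        · subst hj; simp [hi]
        · simp [hj]
      rw [this, translate_mul, Finset.card_insert_of_notMem hi]
      set y := translate μ q (fun j => if j ∈ S then x j else 1) f
      set T := translate μ q (Pi.mulSingle i (x i) : ∀ i, H i)
      have e : T y - f = T (y - f) + (T f - f) := by rw [map_sub]; abel
      rw [e]
      refine (norm_add_le _ _).trans ?_
      rw [norm_translate]
      push_cast
      linarith [h i]
  have := key Finset.univ
  simpa using this

variable (μ q) in
/-- The translations by the `i`-th factor of a product group. -/
abbrev factorTranslate (i : ι) (a : H i) : Lp ℝ q μ →L[ℝ] Lp ℝ q μ :=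
  translate μ q (Pi.mulSingle i a)

lemma factorTranslate_comm {i j : ι} (hij : i ≠ j) (a : H i) (b : H j) (f : Lp ℝ q μ) :
    factorTranslate μ q i a (factorTranslate μ q j b f)
      = factorTranslate μ q j b (factorTranslate μ q i a f) := by
  rw [← translate_mul, ← translate_mul, (Pi.mulSingle_commute hij a b).eq]

variable [∀ i, TopologicalSpace (H i)] [∀ i, IsTopologicalGroup (H i)]
  [TopologicalSpace X] [BorelSpace X] [R1Space X] [ContinuousSMul (∀ i, H i) X]
  [μ.InnerRegularCompactLTTop] [IsLocallyFiniteMeasure μ]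

lemma isContractionFamily_factorTranslate (hq : q ≠ ∞) (i : ι) :
    IsContractionFamily (factorTranslate (H := H) μ q i) :=
  ⟨fun _ f => (norm_translate _ f).le,
    fun f => (continuous_translate hq f).comp (continuous_mulSingle i)⟩

variable [IsProbabilityMeasure μ] [∀ i, LocallyCompactSpace (H i)] [∀ i, T2Space (H i)]
  [∀ i, SigmaCompactSpace (H i)] [∀ i, MeasurableSpace (H i)] [∀ i, BorelSpace (H i)]
  {m : ∀ i, Measure (H i)} [∀ i, IsProbabilityMeasure (m i)]

variable (μ m) in
/-- The average over the `i`-th factor of a product group acting on `L^q`. -/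
def factorAverage [Fact (q ≠ ∞)] (i : ι) : Lp ℝ q μ →L[ℝ] Lp ℝ q μ :=
  (isContractionFamily_factorTranslate (H := H) (μ := μ) (q := q) Fact.out i).average (m i)

instance : Fact ((1 : ℝ≥0∞) ≠ ∞) := ⟨by simp⟩
instance : Fact ((2 : ℝ≥0∞) ≠ ∞) := ⟨by simp⟩

variable [Fact (q ≠ ∞)]

lemma norm_factorAverage_le (i : ι) (f : Lp ℝ q μ) : ‖factorAverage μ m i f‖ ≤ ‖f‖ :=
  IsContractionFamily.norm_average_le _ _ f

lemma factorAverage_translate {i j : ι} (hij : i ≠ j) (b : H j) (f : Lp ℝ q μ) :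
    factorAverage μ m i (factorTranslate μ q j b f)
      = factorTranslate μ q j b (factorAverage μ m i f) := 
  (IsContractionFamily.map_average _ _ _ (translate μ q (Pi.mulSingle j b))
    (fun a v => (factorTranslate_comm hij a b v).symm) f).symm

lemma factorAverage_comm (i j : ι) (f : Lp ℝ q μ) :
    factorAverage μ m i (factorAverage μ m j f) = factorAverage μ m j (factorAverage μ m i f) := by
  by_cases hij : i = j
  · subst hij; rfl
  · exact IsContractionFamily.map_average _ _ _ (factorAverage μ m i)
      (fun a v => factorAverage_translate hij a v) f

lemma inclusionL2L1_factorAverage (i : ι) (f : Lp ℝ 2 μ) :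
    inclusionL2L1 μ (factorAverage μ m i f) = factorAverage μ m i (inclusionL2L1 μ f) :=
  IsContractionFamily.map_average _ _ _ (inclusionL2L1 μ)
    (fun _ v => inclusionL2L1_translate _ v) f

/-- The integral is a translation-invariant continuous functional on $L^1$, so it commutes with the
Bochner average. -/
lemma integral_factorAverage (i : ι) (f : Lp ℝ 1 μ) :
    ∫ x, factorAverage μ m i f x ∂μ = ∫ x, f x ∂μ := by
  have h1 : ∀ f : Lp ℝ 1 μ, L1.integralCLM' ℝ f = ∫ x, f x ∂μ := fun f => by
    rw [← L1.integral_eq_integral, L1.integral_eq]; rfl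
  rw [← h1, ← h1, factorAverage, IsContractionFamily.average_apply,
    ← ContinuousLinearMap.integral_comp_comm _ (IsContractionFamily.integrable 
      (isContractionFamily_factorTranslate Fact.out i) _ f)]
  simp only [h1, integral_translate]
  simp

lemma factorAverage_mem_L20 (i : ι) {f : Lp ℝ 2 μ} (hf : f ∈ L20 μ) :
    factorAverage μ m i f ∈ L20 μ := by
  rw [mem_L20_iff] at hf ⊢
  rw [← integral_inclusionL2L1, inclusionL2L1_factorAverage, integral_factorAverage,
    integral_inclusionL2L1, hf]

variable [Nonempty ι]

/-- If `L²₀` does not almost have invariant vectors, the mean of the averages over the factors is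
a strict contraction of `L²₀`. -/
lemma exists_norm_meanOperator_le (hwc : ¬ AlmostHasInvariantVectors
      (quasiRegularZero (G := ∀ i, H i) μ)) (hm : ∀ i, IsSpread (m i)) :
    ∃ r : ℝ, 0 < r ∧ r < 1 ∧ ∀ v ∈ L20 μ,
      ‖meanOperator (fun i => factorAverage (q := 2) μ m i) v‖ ≤ r * ‖v‖ := by
  unfold AlmostHasInvariantVectors at hwc
  push Not at hwc
  obtain ⟨K, hK, ε, hε, hv⟩ := hwc
  set n : ℝ := (Fintype.card ι : ℝ) with hn
  have hn0 : 0 < n := by positivity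
  -- Each factor moves $v$ by at most $4\eta$, so all $n$ move it by at most $\varepsilon/4$, and
  -- the orbit of `K` has diameter at most $\varepsilon/2$.
  set η : ℝ := ε / (16 * n) with hη
  have hη0 : 0 < η := by positivity
  have hd : ∀ i, ∃ δ : ℝ, 0 < δ ∧ ∀ v : Lp ℝ 2 μ, ‖v‖ = 1 → 1 - δ < ‖factorAverage μ m i v‖ →
      ∀ k ∈ (fun x : ∀ i, H i => x i) '' K, ‖factorTranslate μ 2 i k v - v‖ ≤ 4 * η := fun i =>
    (hm i).exists_displacement_le (isContractionFamily_factorTranslate Fact.out i)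
      (fun a v => norm_translate _ v) (fun v => by simp [factorTranslate, translate_one])
      (fun a b v => by rw [factorTranslate, Pi.mulSingle_mul, translate_mul])
      (hK.image (continuous_apply i)) hη0
  choose δ hδ0 hδ using hd
  obtain ⟨i₀, -, hi₀⟩ := Finset.exists_min_image Finset.univ δ Finset.univ_nonempty
  have hunit : ∀ v ∈ L20 μ, ‖v‖ = 1 →
      ‖meanOperator (fun i => factorAverage (q := 2) μ m i) v‖ ≤ 1 - δ i₀ / n := by
    intro v hv0 hv1
    by_contra! hlt
    -- The other $n-1$ averages have norm at most $1$, so a mean of norm above $1-\delta_{i_0}/n$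
    -- leaves no room for a single short one.
    have hi : ∀ i, 1 - δ i < ‖factorAverage μ m i v‖ := fun i => by
      rw [meanOperator_apply, norm_smul, norm_inv, RCLike.norm_natCast, ← hn,
        lt_inv_mul_iff₀ hn0] at hlt
      have h1 : ‖∑ j, factorAverage μ m j v‖ ≤ ‖factorAverage μ m i v‖ + (n - 1) := by
        rw [← Finset.add_sum_erase _ _ (Finset.mem_univ i)]
        refine (norm_add_le _ _).trans (add_le_add_right ?_ _)
        calc _ ≤ ∑ j ∈ Finset.univ.erase i, ‖factorAverage μ m j v‖ := norm_sum_le _ _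
          _ ≤ ∑ _j ∈ Finset.univ.erase i, (1 : ℝ) :=
            Finset.sum_le_sum fun j _ => hv1 ▸ norm_factorAverage_le j v
          _ = n - 1 := by
            simp [Finset.card_erase_of_mem, hn, Nat.cast_sub Fintype.card_pos]
      have h2 : n * (1 - δ i₀ / n) = n - δ i₀ := by field_simp
      linarith [hi₀ i (Finset.mem_univ i)]
    have hdisp : ∀ k ∈ K, ‖translate μ 2 k v - v‖ ≤ ε / 4 := fun k hk => by
      have := norm_translate_sub_le (f := v) (x := k) (s := 4 * η)
        fun i => hδ i v hv1 (hi i) (k i) ⟨k, hk, rfl⟩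
      refine this.trans (le_of_eq ?_)
      rw [← hn, hη]; field_simp; norm_num
    have := hv ⟨v, hv0⟩ hv1
    have hle : Metric.diam ((fun g => quasiRegularZero (G := ∀ i, H i) μ g ⟨v, hv0⟩) '' K)
        ≤ ε / 2 := by
      refine Metric.diam_le_of_forall_dist_le (by positivity) ?_
      rintro _ ⟨k, hk, rfl⟩ _ ⟨l, hl, rfl⟩
      change dist (translate μ 2 k v) (translate μ 2 l v) ≤ _
      have := dist_triangle_right (translate μ 2 k v) (translate μ 2 l v) v
      rw [dist_eq_norm _ v, dist_eq_norm _ v] at this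
      linarith [hdisp k hk, hdisp l hl]
    linarith
  -- The maximum with $1/2$ only secures a positive rate.
  refine ⟨max (1 - δ i₀ / n) (1 / 2), by positivity, max_lt ?_ (by norm_num), fun v hv0 => ?_⟩
  · have : 0 < δ i₀ / n := div_pos (hδ0 i₀) hn0
    linarith
  · by_cases hz : v = 0
    · simp [hz]
    have hz' : ‖v‖ ≠ 0 := norm_ne_zero_iff.2 hz
    have h1 := hunit (‖v‖⁻¹ • v) ((L20 μ).smul_mem _ hv0) (by
      rw [norm_smul, norm_inv, norm_norm, inv_mul_cancel₀ hz'])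
    rw [map_smul, norm_smul, norm_inv, norm_norm, inv_mul_le_iff₀ (by positivity)] at h1
    rw [mul_comm]
    exact h1.trans (by gcongr; exact le_max_left _ _)

end ProductAction

/-! ### Centring, and approximation of $L^1$ functions by $L^2$ functions. -/

section Truncation

variable {X : Type*} [MeasurableSpace X] {μ : Measure X} [IsProbabilityMeasure μ]

lemma abs_integral_le_norm (f : Lp ℝ 1 μ) : |∫ x, f x ∂μ| ≤ ‖f‖ := by
  rw [L1.norm_eq_integral_norm]
  exact norm_integral_le_integral_norm (μ := μ) (fun x => f x)

lemma norm_const_eq (q : ℝ≥0∞) (hq : q ≠ 0) (c : ℝ) : ‖Lp.const q μ c‖ = |c| := by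
  rw [Lp.norm_const q μ c hq]
  simp

/-- The projection of `f` to the functions of mean zero. -/
def centered (f : Lp ℝ 1 μ) : Lp ℝ 1 μ := f - Lp.const 1 μ (∫ x, f x ∂μ)

lemma integral_sub_Lp (f g : Lp ℝ 1 μ) :
    ∫ x, (f - g) x ∂μ = ∫ x, f x ∂μ - ∫ x, g x ∂μ := by
  rw [integral_congr_ae (Lp.coeFn_sub f g)]
  exact integral_sub (L1.integrable_coeFn f) (L1.integrable_coeFn g)

lemma integral_add_Lp (f g : Lp ℝ 1 μ) :
    ∫ x, (f + g) x ∂μ = ∫ x, f x ∂μ + ∫ x, g x ∂μ := by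
  rw [integral_congr_ae (Lp.coeFn_add f g)]
  exact integral_add (L1.integrable_coeFn f) (L1.integrable_coeFn g)

lemma integral_const_Lp (q : ℝ≥0∞) (c : ℝ) : ∫ x, Lp.const q μ c x ∂μ = c := by
  rw [integral_congr_ae (Lp.coeFn_const q μ c)]
  simp

lemma norm_centered_le (f : Lp ℝ 1 μ) : ‖centered f‖ ≤ 2 * ‖f‖ := by
  refine (norm_sub_le _ _).trans ?_
  rw [norm_const_eq 1 one_ne_zero]
  linarith [abs_integral_le_norm f]

lemma centered_sub (f g : Lp ℝ 1 μ) : centered (f - g) = centered f - centered g := by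
  rw [centered, centered, centered, integral_sub_Lp, map_sub]
  abel

lemma centered_add (f g : Lp ℝ 1 μ) : centered (f + g) = centered f + centered g := by
  rw [centered, centered, centered, integral_add_Lp, map_add]
  abel

/-- An `L¹`-function with finite `p`-th moment is approximated by functions of `L²` with a
quantitative control. -/
lemma exists_truncation {p : ℝ} (hp : 1 < p) (f : Lp ℝ 1 μ) {M : ℝ} (hM : 0 ≤ M)
    (hf : ∫⁻ x, ‖f x‖ₑ ^ p ∂μ ≤ ENNReal.ofReal M) {t : ℝ} (ht : 0 < t) :
    ∃ g : Lp ℝ 2 μ, ‖g‖ ≤ t ∧ ‖f - inclusionL2L1 μ g‖ ≤ t ^ (1 - p) * M := by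
  have hfm : Measurable f := (Lp.stronglyMeasurable f).measurable
  let S : Set X := {x | ‖f x‖ ≤ t}
  have hS : MeasurableSet S := measurableSet_le hfm.norm measurable_const
  have hbound : ∀ x, ‖S.indicator f x‖ ≤ t := fun x => by
    by_cases hx : x ∈ S
    · rw [Set.indicator_of_mem hx]; exact hx
    · rw [Set.indicator_of_notMem hx, norm_zero]; exact ht.le
  have hmem : MemLp (S.indicator f) 2 μ :=
    MemLp.of_bound (hfm.indicator hS).aestronglyMeasurable t (ae_of_all _ hbound)
  have hae : inclusionL2L1 μ (hmem.toLp _) =ᵐ[μ] S.indicator f :=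
    (inclusionL2L1_ae_eq _).trans hmem.coeFn_toLp
  refine ⟨hmem.toLp _, ?_, ?_⟩
  · refine (Lp.norm_le_of_ae_bound ht.le (C := t) ?_).trans (by simp [measureUnivNNReal])
    filter_upwards [hmem.coeFn_toLp] with x hx
    rw [hx]; exact hbound x
  · have hint : Integrable (fun x => ‖f x‖ ^ p) μ := by
      refine ⟨(hfm.norm.pow_const p).aestronglyMeasurable, ?_⟩
      refine lt_of_le_of_lt ?_ (hf.trans_lt ENNReal.ofReal_lt_top)
      refine lintegral_mono fun x => ?_
      rw [Real.enorm_rpow_of_nonneg (norm_nonneg _) (by linarith), enorm_norm]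
    have hintM : ∫ x, ‖f x‖ ^ p ∂μ ≤ M := by
      rw [integral_eq_lintegral_of_nonneg_ae (ae_of_all _ fun x => by positivity) hint.1]
      refine ENNReal.toReal_le_of_le_ofReal hM (le_trans (le_of_eq ?_) hf)
      refine lintegral_congr fun x => ?_
      rw [← ENNReal.ofReal_rpow_of_nonneg (norm_nonneg _) (by linarith), ofReal_norm]
    rw [L1.norm_eq_integral_norm]
    calc ∫ x, ‖(f - inclusionL2L1 μ (hmem.toLp _)) x‖ ∂μ ≤ ∫ x, t ^ (1 - p) * ‖f x‖ ^ p ∂μ := by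
          refine integral_mono_ae (L1.integrable_coeFn _).norm (hint.const_mul _) ?_
          filter_upwards [hae, Lp.coeFn_sub f (inclusionL2L1 μ (hmem.toLp _))] with x h1 h2
          rw [h2, Pi.sub_apply, h1]
          by_cases hx : x ∈ S
          · rw [Set.indicator_of_mem hx, sub_self, norm_zero]; positivity
          · rw [Set.indicator_of_notMem hx, sub_zero]
            have hx' : t < ‖f x‖ := not_le.1 hx
            have h0 : 0 < ‖f x‖ := ht.trans hx'
            -- Above the truncation height the factor with negative exponent $1-p$ is at most
            -- $t^{1-p}$.
            calc ‖f x‖ = ‖f x‖ ^ (1 - p) * ‖f x‖ ^ p := by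
                  rw [← Real.rpow_add h0]; simp
              _ ≤ t ^ (1 - p) * ‖f x‖ ^ p := by
                  refine mul_le_mul_of_nonneg_right ?_ (by positivity)
                  exact Real.rpow_le_rpow_of_nonpos ht hx'.le (by linarith)
      _ = t ^ (1 - p) * ∫ x, ‖f x‖ ^ p ∂μ := integral_const_mul _ _
      _ ≤ _ := by gcongr

lemma exists_norm_sub_inclusionL2L1_le (f : Lp ℝ 1 μ) {ε : ℝ} (hε : 0 < ε) :
    ∃ g : Lp ℝ 2 μ, ‖f - inclusionL2L1 μ g‖ ≤ ε := by
  obtain ⟨s, hs, -⟩ := (Lp.memLp f).exists_simpleFunc_eLpNorm_sub_lt (by simp)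
    (ε := ENNReal.ofReal ε) (by simpa using hε)
  have hmem : MemLp s 2 μ := s.memLp_of_isFiniteMeasure 2 μ
  refine ⟨hmem.toLp _, ?_⟩
  rw [Lp.norm_def]
  refine ENNReal.toReal_le_of_le_ofReal hε.le (le_trans (le_of_eq (eLpNorm_congr_ae ?_)) hs.le)
  exact (Lp.coeFn_sub _ _).trans
    ((ae_eq_refl _).sub ((inclusionL2L1_ae_eq _).trans hmem.coeFn_toLp))

end Truncation

/-! ### Exponential decay in $L^1$, and fixed vectors of a factor average. -/

section Cocycle

variable {ι : Type*} [Fintype ι] [DecidableEq ι] [Nonempty ι] {H : ι → Type*} [∀ i, Group (H i)]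
  [∀ i, TopologicalSpace (H i)] [∀ i, IsTopologicalGroup (H i)]
  [∀ i, LocallyCompactSpace (H i)] [∀ i, T2Space (H i)]
  [∀ i, SigmaCompactSpace (H i)] [∀ i, MeasurableSpace (H i)] [∀ i, BorelSpace (H i)]
  {X : Type*} [MulAction (∀ i, H i) X] [MeasurableSpace X]
  [MeasurableConstSMul (∀ i, H i) X] {μ : Measure X} [SMulInvariantMeasure (∀ i, H i) X μ]
  [TopologicalSpace X] [BorelSpace X] [R1Space X] [ContinuousSMul (∀ i, H i) X]
  [μ.InnerRegularCompactLTTop] [IsLocallyFiniteMeasure μ] [IsProbabilityMeasure μ]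

section Fixed

variable {m : ∀ i, Measure (H i)} [∀ i, IsProbabilityMeasure (m i)]

/-- Truncate at height $t=r^{-k/2}$. The bounded part has $L^2$ norm at most $t$, doubled by
centring, and $Q^k$ shrinks it to $2r^{k/2}$. The tail has $L^1$ norm at most
$t^{1-p}M=r^{k(p-1)/2}M$, and $Q^k$ does not expand it. The condition $p>1$ makes both bounds decay.
-/
lemma norm_meanOperator_pow_centered_le {r : ℝ} (hr0 : 0 < r)
    (hr : ∀ v ∈ L20 μ, ‖meanOperator (fun i => factorAverage (q := 2) μ m i) v‖ ≤ r * ‖v‖)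
    {p : ℝ} (hp : 1 < p) (f : Lp ℝ 1 μ) {M : ℝ} (hM : 0 ≤ M)
    (hf : ∫⁻ x, ‖f x‖ₑ ^ p ∂μ ≤ ENNReal.ofReal M) (k : ℕ) :
    ‖(meanOperator (fun i => factorAverage (q := 1) μ m i) ^ k) (centered f)‖
      ≤ (2 + 2 * M) * (max (√r) (√r ^ (p - 1))) ^ k := by
  set s := √r with hs
  have hs0 : 0 < s := Real.sqrt_pos.2 hr0
  have hss : s * s = r := Real.mul_self_sqrt hr0.le
  have ht0 : 0 < (s ^ k)⁻¹ := by positivity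
  obtain ⟨g, hg, hfg⟩ := exists_truncation hp f hM hf ht0
  set t := (s ^ k)⁻¹ with ht
  set Q1 := meanOperator (fun i => factorAverage (q := 1) μ m i)
  set Q2 := meanOperator (fun i => factorAverage (q := 2) μ m i)
  have hpow : ∀ v ∈ L20 μ, ∀ k : ℕ, (Q2 ^ k) v ∈ L20 μ ∧ ‖(Q2 ^ k) v‖ ≤ r ^ k * ‖v‖ := by
    intro v hv k
    induction k with
    | zero => simpa using hv
    | succ k ih =>
      rw [pow_succ', mul_apply_eq_comp]
      refine ⟨?_, (hr _ ih.1).trans ?_⟩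
      · change meanOperator _ _ ∈ _
        rw [meanOperator_apply]
        exact (L20 μ).smul_mem _ ((L20 μ).sum_mem fun i _ => factorAverage_mem_L20 i ih.1)
      · rw [pow_succ', mul_assoc]
        exact mul_le_mul_of_nonneg_left ih.2 hr0.le
  have hig : |∫ x, g x ∂μ| ≤ t := by
    rw [← integral_inclusionL2L1]
    exact (abs_integral_le_norm _).trans ((norm_inclusionL2L1_le g).trans hg)
  set g0 : Lp ℝ 2 μ := g - Lp.const 2 μ (∫ x, g x ∂μ) with hg0
  have hιg0 : inclusionL2L1 μ g0 = centered (inclusionL2L1 μ g) := by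
    rw [hg0, map_sub, inclusionL2L1_const, centered, integral_inclusionL2L1]
  have hg0mem : g0 ∈ L20 μ := by
    rw [mem_L20_iff, ← integral_inclusionL2L1, hιg0, centered, integral_sub_Lp, integral_const_Lp,
      sub_self]
  have hg0n : ‖g0‖ ≤ 2 * t := by
    refine (norm_sub_le _ _).trans ?_
    rw [norm_const_eq 2 two_ne_zero]
    linarith
  have hdec : centered f = inclusionL2L1 μ g0 + centered (f - inclusionL2L1 μ g) := by
    rw [hιg0, ← centered_add]; simp
  have h1 : ‖(Q1 ^ k) (inclusionL2L1 μ g0)‖ ≤ 2 * s ^ k := by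
    rw [← meanOperator_map (inclusionL2L1 μ) (fun i v => inclusionL2L1_factorAverage i v)]
    refine (norm_inclusionL2L1_le _).trans (((hpow g0 hg0mem k).2).trans ?_)
    calc r ^ k * ‖g0‖ ≤ r ^ k * (2 * t) := by gcongr
      _ = 2 * s ^ k := by
        rw [← hss, mul_pow, ht]
        field_simp
  have h2 : ‖(Q1 ^ k) (centered (f - inclusionL2L1 μ g))‖ ≤ 2 * M * (s ^ (p - 1)) ^ k := by
    refine (norm_meanOperator_pow_le (fun i v => norm_factorAverage_le i v) k _).trans ?_
    refine (norm_centered_le _).trans ?_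
    have h3 : t ^ (1 - p) = (s ^ (p - 1)) ^ k := by
      rw [ht, Real.inv_rpow (by positivity), ← Real.rpow_neg (by positivity), neg_sub,
        ← Real.rpow_natCast, ← Real.rpow_natCast, ← Real.rpow_mul hs0.le, ← Real.rpow_mul hs0.le,
        mul_comm]
    rw [h3] at hfg
    linarith
  rw [hdec, map_add]
  refine (norm_add_le _ _).trans ((add_le_add h1 h2).trans ?_)
  have h4 : s ^ k ≤ (max s (s ^ (p - 1))) ^ k := pow_le_pow_left₀ hs0.le (le_max_left _ _) k
  have h5 : (s ^ (p - 1)) ^ k ≤ (max s (s ^ (p - 1))) ^ k :=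
    pow_le_pow_left₀ (by positivity) (le_max_right _ _) k
  rw [add_mul]
  exact add_le_add (by linarith) (mul_le_mul_of_nonneg_left h5 (by positivity))

/-- The extended-valued form also covers infinite moments, so the bound can be integrated along a
factor directly. -/
lemma enorm_meanOperator_pow_centered_le {r : ℝ} (hr0 : 0 < r)
    (hr : ∀ v ∈ L20 μ, ‖meanOperator (fun i => factorAverage (q := 2) μ m i) v‖ ≤ r * ‖v‖)
    {p : ℝ} (hp : 1 < p) (f : Lp ℝ 1 μ) (k : ℕ) :
    ‖(meanOperator (fun i => factorAverage (q := 1) μ m i) ^ k) (centered f)‖ₑ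
      ≤ (2 + 2 * ∫⁻ x, ‖f x‖ₑ ^ p ∂μ) * ENNReal.ofReal ((max (√r) (√r ^ (p - 1))) ^ k) := by
  have hs0 : 0 < √r := Real.sqrt_pos.2 hr0
  by_cases hI : ∫⁻ x, ‖f x‖ₑ ^ p ∂μ = ∞
  · rw [hI, ENNReal.mul_top two_ne_zero, add_top, ENNReal.top_mul]
    · exact le_top
    · simp only [ne_eq, ENNReal.ofReal_eq_zero, not_le]
      exact pow_pos (hs0.trans_le (le_max_left _ _)) k
  · have := norm_meanOperator_pow_centered_le (m := m) hr0 hr hp f ENNReal.toReal_nonneg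
      (ENNReal.ofReal_toReal hI).ge k
    rw [← ofReal_norm]
    refine (ENNReal.ofReal_le_ofReal this).trans (le_of_eq ?_)
    rw [ENNReal.ofReal_mul (by positivity), ENNReal.ofReal_add (by simp) (by positivity),
      ENNReal.ofReal_mul (by simp), ENNReal.ofReal_toReal hI]
    simp

/-- An `L¹`-function fixed by the average over a factor is invariant under that factor. -/
lemma factorTranslate_eq_of_factorAverage_eq {i : ι} (hm : IsSpread (m i)) {u : Lp ℝ 1 μ}
    (hu : factorAverage μ m i u = u) (a : H i) : factorTranslate μ 1 i a u = u := by
  refine eq_of_forall_dist_le fun ε hε => ?_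
  -- The variance argument needs a Hilbert space, so $u$ is approximated by a fixed vector of $L^2$:
  -- the limit $e$ of the ergodic averages of a nearby $g$. These averages stay within
  -- $\varepsilon/2$ of $u$ because $u$ is fixed.
  obtain ⟨g, hg⟩ := exists_norm_sub_inclusionL2L1_le u (half_pos hε)
  set T : Lp ℝ 2 μ →L[ℝ] Lp ℝ 2 μ := factorAverage μ m i with hT
  have hlim := ContinuousLinearMap.tendsto_birkhoffAverage_orthogonalProjection T
    (ContinuousLinearMap.opNorm_le_bound _ zero_le_one fun v => by
      rw [one_mul]; exact norm_factorAverage_le i v) g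
  set e := ((T : Lp ℝ 2 μ →ₗ[ℝ] Lp ℝ 2 μ).eqLocus
    ((1 : Lp ℝ 2 μ →L[ℝ] Lp ℝ 2 μ) : Lp ℝ 2 μ →ₗ[ℝ] Lp ℝ 2 μ)).orthogonalProjectionOnto g with he
  have heT : T e = e := e.2
  have heρ : factorTranslate μ 2 i a e = e :=
    hm.eq_of_average_eq (isContractionFamily_factorTranslate Fact.out i)
      (fun a v => norm_translate _ v) heT a
  have hiter : ∀ k, ‖inclusionL2L1 μ (T^[k] g) - u‖ ≤ ε / 2 := by
    intro k
    induction k with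
    | zero => rw [norm_sub_rev]; exact hg
    | succ k ih =>
      rw [Function.iterate_succ_apply', hT, inclusionL2L1_factorAverage]
      refine le_trans (le_of_eq ?_) ((norm_factorAverage_le (m := m) i _).trans ih)
      rw [map_sub, hu]
  have havg : ∀ N : ℕ, 0 < N → ‖inclusionL2L1 μ (birkhoffAverage ℝ T id N g) - u‖ ≤ ε / 2 := by
    intro N hN
    have hN' : (N : ℝ) ≠ 0 := by positivity
    have : inclusionL2L1 μ (birkhoffAverage ℝ T id N g) - u
        = (N : ℝ)⁻¹ • ∑ k ∈ Finset.range N, (inclusionL2L1 μ (T^[k] g) - u) := by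
      rw [birkhoffAverage, birkhoffSum, map_smul, map_sum, Finset.sum_sub_distrib, smul_sub]
      simp only [id, Finset.sum_const, Finset.card_range]
      rw [← Nat.cast_smul_eq_nsmul ℝ, smul_smul, inv_mul_cancel₀ hN', one_smul]
    rw [this, norm_smul, norm_inv, RCLike.norm_natCast, inv_mul_le_iff₀ (by positivity)]
    calc _ ≤ ∑ k ∈ Finset.range N, ‖inclusionL2L1 μ (T^[k] g) - u‖ := norm_sum_le _ _
      _ ≤ ∑ _k ∈ Finset.range N, ε / 2 := Finset.sum_le_sum fun k _ => hiter k
      _ = _ := by simp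
  have hclose : ‖inclusionL2L1 μ e - u‖ ≤ ε / 2 := by
    refine le_of_tendsto ((((inclusionL2L1 μ).continuous.tendsto _).comp hlim).sub_const u).norm ?_
    filter_upwards [Filter.eventually_gt_atTop 0] with N hN using havg N hN
  have hclose' : ‖inclusionL2L1 μ e - factorTranslate μ 1 i a u‖ ≤ ε / 2 := by
    nth_rewrite 1 [← heρ]
    rw [inclusionL2L1_translate, ← map_sub, norm_translate]
    exact hclose
  refine (dist_triangle_left _ _ (inclusionL2L1 μ e)).trans ?_
  rw [dist_eq_norm, dist_eq_norm]
  linarith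

end Fixed

end Cocycle

/-! ### Vanishing of the centred cocycle. -/

section Cocycle

variable {ι : Type*} [Fintype ι] [DecidableEq ι] [Nonempty ι] {H : ι → Type*} [∀ i, Group (H i)]
  [∀ i, TopologicalSpace (H i)] [∀ i, IsTopologicalGroup (H i)]
  [∀ i, LocallyCompactSpace (H i)] [∀ i, T2Space (H i)]
  [∀ i, SigmaCompactSpace (H i)] 
  {X : Type*} [MulAction (∀ i, H i) X] [MeasurableSpace X]
  [MeasurableConstSMul (∀ i, H i) X] {μ : Measure X} [SMulInvariantMeasure (∀ i, H i) X μ]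
  [TopologicalSpace X] [BorelSpace X] [R1Space X] [ContinuousSMul (∀ i, H i) X]
  [μ.InnerRegularCompactLTTop] [IsLocallyFiniteMeasure μ] [IsProbabilityMeasure μ]

lemma centered_translate (g : ∀ i, H i) (f : Lp ℝ 1 μ) :
    centered (translate μ 1 g f) = translate μ 1 g (centered f) := by
  rw [centered, centered, map_sub, translate_const, integral_translate]

/-- A continuous `L¹`-cocycle of a product group with locally bounded `p`-th moments is, up to
constants, a coboundary, provided `L²₀` does not almost have invariant vectors and the complement
of each factor acts ergodically. -/
theorem exists_eq_const_add_sub_translate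
    (hwc : ¬ AlmostHasInvariantVectors (quasiRegularZero (G := ∀ i, H i) μ))
    (herg : ∀ (i : ι) (u : Lp ℝ 1 μ),
      (∀ g : ∀ i, H i, g i = 1 → translate μ 1 g u = u) → ∃ c, u = Lp.const 1 μ c)
    {b : (∀ i, H i) → Lp ℝ 1 μ} (hb : ∀ g h, b (g * h) = b g + translate μ 1 g (b h))
    (hbc : Continuous b) {p : ℝ} (hp : 1 < p)
    (hbp : ∀ C : Set (∀ i, H i), IsCompact C →
      ∃ M : NNReal, ∀ g ∈ C, ∫⁻ x, ‖b g x‖ₑ ^ p ∂μ ≤ M) :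
    ∃ v : Lp ℝ 1 μ, ∀ g, b g = Lp.const 1 μ (∫ x, b g x ∂μ) + v - translate μ 1 g v := by
  let _ : ∀ i, MeasurableSpace (H i) := fun i => borel (H i)
  have _ : ∀ i, BorelSpace (H i) := fun i => ⟨rfl⟩
  have hm : ∀ i, ∃ m : Measure (H i), IsProbabilityMeasure m ∧ IsSpread m ∧
      ∫⁻ a, (∫⁻ x, ‖b (Pi.mulSingle i a) x‖ₑ ^ p ∂μ) ∂m < ∞ := fun i => by
    refine exists_isSpread _ fun C hC => ?_
    obtain ⟨M, hM⟩ := hbp _ (hC.image (continuous_mulSingle i))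
    exact ⟨M, fun a ha => hM _ ⟨a, ha, rfl⟩⟩
  choose m hmp hms hmN using hm
  obtain ⟨r, hr0, hr1, hr⟩ := exists_norm_meanOperator_le (m := m) hwc hms
  set P : ι → Lp ℝ 1 μ →L[ℝ] Lp ℝ 1 μ := fun i => factorAverage μ m i with hPdef
  set θ := max (√r) (√r ^ (p - 1)) with hθ
  have hs0 : 0 < √r := Real.sqrt_pos.2 hr0
  have hs1 : √r < 1 := by rw [Real.sqrt_lt' one_pos]; simpa using hr1
  have hθ0 : 0 < θ := hs0.trans_le (le_max_left _ _)
  have hθ1 : θ < 1 := max_lt hs1 (Real.rpow_lt_one hs0.le hs1 (by linarith))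
  set b0 : (∀ i, H i) → Lp ℝ 1 μ := fun g => centered (b g) with hb0def
  have hb0 : ∀ g h, b0 (g * h) = b0 g + translate μ 1 g (b0 h) := fun g h => by
    simp only [hb0def]
    rw [hb, centered_add, centered_translate]
  have hb0c : Continuous b0 := by
    have : LipschitzWith 2 (centered (μ := μ)) := LipschitzWith.of_dist_le_mul fun f g => by
      rw [dist_eq_norm, dist_eq_norm, ← centered_sub]
      exact norm_centered_le _
    exact this.continuous.comp hbc
  have hdec : ∀ (k : ℕ) (g : ∀ i, H i), ‖(meanOperator P ^ k) (b0 g)‖ₑ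
      ≤ (2 + 2 * ∫⁻ x, ‖b g x‖ₑ ^ p ∂μ) * ENNReal.ofReal (θ ^ k) := fun k g =>
    enorm_meanOperator_pow_centered_le hr0 hr hp (b g) k
  set I : ι → ℝ≥0∞ := fun i =>
    ∫⁻ a, (2 + 2 * ∫⁻ x, ‖b (Pi.mulSingle i a) x‖ₑ ^ p ∂μ) ∂(m i) with hI
  have hItop : ∀ i, I i ≠ ∞ := fun i => by
    simp only [hI]
    rw [lintegral_add_left measurable_const, lintegral_const_mul' _ _ (by simp)]
    exact (ENNReal.add_lt_top.2 ⟨by simp, ENNReal.mul_lt_top (by simp) (hmN i)⟩).ne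
  have hdecI : ∀ (k : ℕ) i, ∫⁻ a, ‖(meanOperator P ^ k) (b0 (Pi.mulSingle i a))‖ₑ ∂(m i)
      ≤ I i * ENNReal.ofReal (θ ^ k) := fun k i => by
    rw [hI, ← lintegral_mul_const' _ _ (by simp)]
    exact lintegral_mono fun a => hdec k _
  have hint : ∀ i, Integrable (fun a => b0 (Pi.mulSingle i a)) (m i) := fun i => by
    refine ⟨(stronglyMeasurable_of_continuous_sigmaCompact
      (hb0c.comp (continuous_mulSingle i))).aestronglyMeasurable, ?_⟩
    have := hdecI 0 i
    simp only [pow_zero, ENNReal.ofReal_one, mul_one] at this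
    exact this.trans_lt (hItop i).lt_top
  set c : ι → Lp ℝ 1 μ := fun i => ∫ a, b0 (Pi.mulSingle i a) ∂(m i) with hc
  have hcdec : ∀ i k, ‖(meanOperator P ^ k) (c i)‖ ≤ (I i).toReal * θ ^ k := fun i k => by
    rw [hc, ← ContinuousLinearMap.integral_comp_comm _ (hint i)]
    refine (norm_integral_le_lintegral_norm _).trans ?_
    refine (ENNReal.toReal_mono (ENNReal.mul_ne_top (hItop i) ENNReal.ofReal_ne_top)
      ((le_of_eq ?_).trans (hdecI k i))).trans (le_of_eq ?_)
    · exact lintegral_congr fun a => ofReal_norm _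
    · rw [ENNReal.toReal_mul, ENNReal.toReal_ofReal (by positivity)]
  -- Elements $a\in H_j$ and $x\in H_i$ commute, so $b_0(xa)=b_0(ax)$; expand both by the cocycle
  -- identity and average over $x$.
  have hcomm : ∀ i j, i ≠ j → ∀ a : H j,
      P i (b0 (Pi.mulSingle j a)) + c i = translate μ 1 (Pi.mulSingle j a) (c i)
        + b0 (Pi.mulSingle j a) := by
    intro i j hij a
    have hF := isContractionFamily_factorTranslate (H := H) (μ := μ) (q := 1) Fact.out i
    have e1 : P i (b0 (Pi.mulSingle j a)) + c i = ∫ x, b0 (Pi.mulSingle j a * Pi.mulSingle i x)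
        ∂(m i) := by
      rw [hc, hPdef]
      simp only []
      rw [factorAverage, IsContractionFamily.average_apply,
        ← integral_add (IsContractionFamily.integrable hF _ _) (hint i)]
      refine integral_congr_ae (ae_of_all _ fun x => ?_)
      simp only []
      rw [← (Pi.mulSingle_commute hij x a).eq, hb0, add_comm]
    have e2 : translate μ 1 (Pi.mulSingle j a) (c i) + b0 (Pi.mulSingle j a)
        = ∫ x, b0 (Pi.mulSingle j a * Pi.mulSingle i x) ∂(m i) := by
      rw [hc]
      simp only []
      rw [← ContinuousLinearMap.integral_comp_comm _ (hint i)]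
      simp only [hb0 (Pi.mulSingle j a)]
      rw [integral_add (integrable_const _) (ContinuousLinearMap.integrable_comp _ (hint i))]
      simp [add_comm]
    rw [e1, e2]
  have hcc : ∀ i j, P i (c j) + c i = P j (c i) + c j := by
    intro i j
    by_cases hij : i = j
    · subst hij; rfl
    have hF := isContractionFamily_factorTranslate (H := H) (μ := μ) (q := 1) Fact.out j
    have e1 : P i (c j) + c i = ∫ a, (P i (b0 (Pi.mulSingle j a)) + c i) ∂(m j) := by
      rw [integral_add (ContinuousLinearMap.integrable_comp _ (hint j)) (integrable_const _),
        ContinuousLinearMap.integral_comp_comm _ (hint j)]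
      simp [hc]
    have e2 : P j (c i) + c j = ∫ a, (translate μ 1 (Pi.mulSingle j a) (c i)
        + b0 (Pi.mulSingle j a)) ∂(m j) := by
      rw [integral_add (IsContractionFamily.integrable hF _ _) (hint j)]
      rfl
    rw [e1, e2]
    simp only [hcomm i j hij]
  obtain ⟨v, hv⟩ := exists_common_fixedPoint (P := P) (c := c)
    (fun i j w => factorAverage_comm i j w) hcc hθ0.le hθ1 hcdec
  have hzero : ∀ i (g : H i), translate μ 1 (Pi.mulSingle i g) v + b0 (Pi.mulSingle i g) = v := by
    intro i g
    -- The defect of $v$ under $g\in H_i$. By `hcomm` and $P_jv+c_j=v$ it is fixed by every $P_j$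
    -- with $j\ne i$.
    set u := translate μ 1 (Pi.mulSingle i g) v + b0 (Pi.mulSingle i g) - v with hu
    have hPu : ∀ j, j ≠ i → P j u = u := fun j hj => by
      have h1 : P j (translate μ 1 (Pi.mulSingle i g) v)
          = translate μ 1 (Pi.mulSingle i g) (P j v) := factorAverage_translate hj g v
      have h2 : P j v = v - c j := by rw [eq_sub_iff_add_eq]; exact hv j
      have h3 : P j (b0 (Pi.mulSingle i g)) = translate μ 1 (Pi.mulSingle i g) (c j)
        + b0 (Pi.mulSingle i g) - c j := by rw [← hcomm j i hj]; abel
      rw [hu, map_sub, map_add, h1, h2, h3, map_sub]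
      abel
    have hinv : ∀ x : ∀ i, H i, x i = 1 → translate μ 1 x u = u := by
      intro x hx
      let S : Subgroup (∀ i, H i) :=
        { carrier := {x | translate μ 1 x u = u}
          one_mem' := translate_one u
          mul_mem' := fun {x y} hx hy => by
            rw [Set.mem_ofPred_eq] at hx hy ⊢
            rw [translate_mul, hy, hx]
          inv_mem' := fun {x} hx => by
            rw [Set.mem_ofPred_eq] at hx ⊢
            nth_rewrite 1 [← hx]
            rw [← translate_mul, inv_mul_cancel, translate_one] }
      refine Subgroup.pi_mem_of_mulSingle_mem (H := S) x fun j => ?_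
      by_cases hj : j = i
      · subst hj
        rw [hx, Pi.mulSingle_one]
        exact S.one_mem
      · exact factorTranslate_eq_of_factorAverage_eq (hms j) (hPu j hj) (x j)
    obtain ⟨d, hd⟩ := herg i u hinv
    have hu0 : ∫ x, u x ∂μ = 0 := by
      rw [hu, integral_sub_Lp, integral_add_Lp, integral_translate, hb0def]
      simp only []
      rw [centered, integral_sub_Lp, integral_const_Lp]
      ring
    rw [hd, integral_const_Lp] at hu0
    rw [hu0, map_zero] at hd
    exact sub_eq_zero.1 hd
  -- The stabiliser of $v$ under the affine action; it contains every factor, hence is everything.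
  let S : Subgroup (∀ i, H i) :=
    { carrier := {x | translate μ 1 x v + b0 x = v}
      one_mem' := by
        have h1 : b0 1 = 0 := by
          have := hb0 1 1
          rw [mul_one, translate_one] at this
          simpa using this
        rw [Set.mem_ofPred_eq, h1, translate_one, add_zero]
      mul_mem' := fun {x y} hx hy => by
        rw [Set.mem_ofPred_eq] at hx hy ⊢
        rw [translate_mul, hb0, add_left_comm, ← map_add, hy, add_comm, hx]
      inv_mem' := fun {x} hx => by
        rw [Set.mem_ofPred_eq] at hx ⊢
        have h1 : b0 1 = 0 := by
          have := hb0 1 1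
          rw [mul_one, translate_one] at this
          simpa using this
        have h2 := hb0 x⁻¹ x
        rw [inv_mul_cancel, h1] at h2
        nth_rewrite 1 [← hx]
        rw [map_add, ← translate_mul, inv_mul_cancel, translate_one, add_assoc, add_comm _ (b0 x⁻¹),
          ← h2, add_zero] }
  refine ⟨v, fun g => ?_⟩
  have hg : translate μ 1 g v + b0 g = v :=
    Subgroup.pi_mem_of_mulSingle_mem (H := S) g fun i => hzero i (g i)
  have : b g = Lp.const 1 μ (∫ x, b g x ∂μ) + b0 g := by
    rw [hb0def]; simp [centered]
  rw [this, integral_add_Lp, integral_const_Lp]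
  have h0 : ∫ x, b0 g x ∂μ = 0 := by
    rw [hb0def]
    simp only []
    rw [centered, integral_sub_Lp, integral_const_Lp, sub_self]
  rw [h0, add_zero, add_sub_assoc]
  congr 1
  rw [eq_sub_iff_add_eq, add_comm]
  exact hg

end Cocycle

attribute [local instance] cosetBorel cosetBorelSpace

/-! ### Borel fundamental domains of a discrete subgroup. -/

section FundamentalDomain

variable {G : Type*} [Group G] [TopologicalSpace G] [IsTopologicalGroup G] [T2Space G]
  [LocallyCompactSpace G] {Γ : Subgroup G} [DiscreteTopology Γ]

/-- By continuity of $(x,y)\mapsto x^{-1}y$ there is a small $U$ with $U^{-1}U\cap\Gamma=\{1\}$; the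
coset map is injective on every left translate of it. -/
lemma exists_isOpen_inv_mul_mem_imp_eq (Γ : Subgroup G) [DiscreteTopology Γ] :
    ∃ U : Set G, IsOpen U ∧ 1 ∈ U ∧ (∃ Q, IsCompact Q ∧ U ⊆ Q) ∧
      ∀ x ∈ U, ∀ y ∈ U, x⁻¹ * y ∈ Γ → x = y := by
  obtain ⟨V, hV, hVΓ⟩ := isOpen_induced_iff.1 (isOpen_discrete ({1} : Set Γ))
  have h1V : (1 : G) ∈ V := by
    have : (1 : Γ) ∈ Subtype.val ⁻¹' V := hVΓ ▸ rfl
    exact this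
  obtain ⟨Q, hQ, hQ1⟩ := exists_compact_mem_nhds (1 : G)
  have hcont : Filter.Tendsto (fun a : G × G => a.1⁻¹ * a.2) (𝓝 (1, 1)) (𝓝 1) := by
    have : Continuous (fun a : G × G => a.1⁻¹ * a.2) := by fun_prop
    simpa using this.tendsto (1, 1)
  have hmem := hcont (hV.mem_nhds h1V)
  rw [Filter.mem_map, nhds_prod_eq, Filter.mem_prod_same_iff] at hmem
  obtain ⟨W, hW, hWV⟩ := hmem
  refine ⟨interior (W ∩ Q), isOpen_interior, mem_interior_iff_mem_nhds.2 (Filter.inter_mem hW hQ1),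
    ⟨Q, hQ, interior_subset.trans Set.inter_subset_right⟩, fun x hx y hy hxy => ?_⟩
  have h2 : x⁻¹ * y ∈ V := hWV (Set.mk_mem_prod (interior_subset hx).1 (interior_subset hy).1)
  have h3 : (⟨x⁻¹ * y, hxy⟩ : Γ) ∈ Subtype.val ⁻¹' V := h2
  rw [hVΓ, Set.mem_singleton_iff, Subtype.ext_iff] at h3
  exact (inv_mul_eq_one.1 h3)

variable [SigmaCompactSpace G]

lemma countable_of_discrete_sigmaCompact (Γ : Subgroup G) [DiscreteTopology Γ] : Countable Γ := by
  have : SigmaCompactSpace Γ :=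
    (Subgroup.isClosed_of_discrete (H := Γ)).isClosedEmbedding_subtypeVal.sigmaCompactSpace
  exact countable_of_Lindelof_of_discrete

variable [MeasurableSpace G] [BorelSpace G]

/-- The coset map, a local homeomorphism, sends Borel sets to Borel sets. -/
lemma measurableSet_image_mk {E : Set G} (hE : MeasurableSet E) :
    MeasurableSet ((QuotientGroup.mk : G → G ⧸ Γ) '' E) := by
  obtain ⟨U, hU, h1U, -, hinj⟩ := exists_isOpen_inv_mul_mem_imp_eq Γ
  let W : G → Set G := fun g => (fun x => g⁻¹ * x) ⁻¹' U
  have hW : ∀ g, IsOpen (W g) := fun g => hU.preimage (by fun_prop)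
  have hWg : ∀ g, W g ∈ 𝓝 g := fun g => (hW g).mem_nhds (by simpa [W] using h1U)
  obtain ⟨S, hS, hSU⟩ := countable_cover_nhds_of_sigmaCompact hWg
  have : (QuotientGroup.mk : G → G ⧸ Γ) '' E
      = ⋃ g ∈ S, (QuotientGroup.mk : G → G ⧸ Γ) '' (E ∩ W g) := by
    rw [← Set.image_iUnion₂, ← Set.inter_iUnion₂, hSU, Set.inter_univ]
  rw [this]
  refine MeasurableSet.biUnion hS fun g _ => ?_
  have hemb : Topology.IsOpenEmbedding (fun x : W g => (QuotientGroup.mk x.1 : G ⧸ Γ)) := by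
    refine Topology.IsOpenEmbedding.of_continuous_injective_isOpenMap
      (QuotientGroup.continuous_mk.comp continuous_subtype_val) ?_
      (QuotientGroup.isOpenMap_coe.comp (hW g).isOpenMap_subtype_val)
    rintro ⟨x, hx⟩ ⟨y, hy⟩ hxy
    have hxy' : x⁻¹ * y ∈ Γ := QuotientGroup.eq.1 hxy
    have := hinj _ hx _ hy (by simpa [mul_assoc] using hxy')
    exact Subtype.ext (mul_left_cancel this)
  have h2 : (QuotientGroup.mk : G → G ⧸ Γ) '' (E ∩ W g)
      = (fun x : W g => (QuotientGroup.mk x.1 : G ⧸ Γ)) '' (Subtype.val ⁻¹' E) := by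
    ext y
    constructor
    · rintro ⟨x, ⟨hx, hxW⟩, rfl⟩
      exact ⟨⟨x, hxW⟩, hx, rfl⟩
    · rintro ⟨⟨x, hxW⟩, hx, rfl⟩
      exact ⟨x, ⟨hx, hxW⟩, rfl⟩
  rw [h2]
  exact hemb.measurableEmbedding.measurableSet_image.2 (measurable_subtype_coe hE)

/-- Cover $G/\Gamma$ by the images of countably many translates of $U$, and keep in each translate
the points whose coset is not met earlier. When $G/\Gamma$ is compact finitely many distinct
translates suffice, which confines $D$ to a compact set. -/
lemma exists_isBorelFundamentalDomain (Γ : Subgroup G) [DiscreteTopology Γ] :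
    ∃ D : Set G, IsBorelFundamentalDomain Γ D ∧
      (CompactSpace (G ⧸ Γ) → ∃ Q, IsCompact Q ∧ D ⊆ Q) := by
  obtain ⟨U, hU, h1U, ⟨Q, hQ, hUQ⟩, hinj⟩ := exists_isOpen_inv_mul_mem_imp_eq Γ
  let W : G → Set G := fun g => (fun x => g⁻¹ * x) ⁻¹' U
  have hW : ∀ g, IsOpen (W g) := fun g => hU.preimage (by fun_prop)
  have h1W : ∀ g, g ∈ W g := fun g => by simpa [W] using h1U
  have hWg : ∀ g, W g ∈ 𝓝 g := fun g => (hW g).mem_nhds (h1W g)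
  have hpW : ∀ g, IsOpen ((QuotientGroup.mk : G → G ⧸ Γ) '' W g) := fun g =>
    QuotientGroup.isOpenMap_coe _ (hW g)
  have hcover : ∃ S : Set G, S.Countable ∧ (∀ x : G, ∃ g ∈ S, ∃ w ∈ W g,
      (QuotientGroup.mk w : G ⧸ Γ) = QuotientGroup.mk x) ∧
      (CompactSpace (G ⧸ Γ) → S.Finite) := by
    by_cases hc : CompactSpace (G ⧸ Γ)
    · obtain ⟨t, ht⟩ := isCompact_univ.elim_finite_subcover _ hpW (fun y _ => by
        obtain ⟨x, rfl⟩ := QuotientGroup.mk_surjective y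
        exact Set.mem_iUnion.2 ⟨x, x, h1W x, rfl⟩)
      refine ⟨t, t.countable_toSet, fun x => ?_, fun _ => t.finite_toSet⟩
      obtain ⟨g, hg, w, hw, hwx⟩ := Set.mem_iUnion₂.1 (ht (Set.mem_univ (QuotientGroup.mk x)))
      exact ⟨g, hg, w, hw, hwx⟩
    · obtain ⟨S, hS, hSU⟩ := countable_cover_nhds_of_sigmaCompact hWg
      refine ⟨S, hS, fun x => ?_, fun h => absurd h hc⟩
      obtain ⟨g, hg, hx⟩ := Set.mem_iUnion₂.1 (hSU.symm ▸ Set.mem_univ x : x ∈ ⋃ g ∈ S, W g)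
      exact ⟨g, hg, x, hx, rfl⟩
  obtain ⟨S, hSc, hS, hSfin⟩ := hcover
  have hne : S.Nonempty := let ⟨g, hg, _⟩ := hS 1; ⟨g, hg⟩
  obtain ⟨g, rfl⟩ := hSc.exists_eq_range hne
  let V : ℕ → Set G := fun n => QuotientGroup.mk ⁻¹' ((QuotientGroup.mk : G → G ⧸ Γ) '' W (g n))
  have hV : ∀ n, IsOpen (V n) := fun n => (hpW _).preimage QuotientGroup.continuous_mk
  let D : Set G := ⋃ n, (W (g n) \ ⋃ k < n, V k)
  refine ⟨D, ⟨?_, fun x => ?_⟩, fun hc => ?_⟩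
  · rw [← BorelSpace.measurable_eq (α := G)]
    exact MeasurableSet.iUnion fun n => (hW _).measurableSet.diff
      (MeasurableSet.biUnion (Set.to_countable _) fun k _ => (hV k).measurableSet)
  · have hex : ∃ n, x ∈ V n := by
      obtain ⟨_, ⟨n, rfl⟩, w, hw, hwx⟩ := hS x
      exact ⟨n, w, hw, hwx⟩
    classical
    obtain ⟨w, hw, hwx⟩ := Nat.find_spec hex
    have hxw : x⁻¹ * w ∈ Γ := QuotientGroup.eq.1 hwx.symm
    have hmk : ∀ γ : Γ, (QuotientGroup.mk (x * γ) : G ⧸ Γ) = QuotientGroup.mk x := fun γ =>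
      QuotientGroup.mk_mul_of_mem x γ.2
    have hVγ : ∀ n (γ : Γ), x * γ ∈ V n ↔ x ∈ V n := fun n γ => by
      simp only [V, Set.mem_preimage, hmk]
    have hn : ∀ n (γ : Γ), x * γ ∈ W (g n) \ ⋃ k < n, V k → n = Nat.find hex := by
      rintro n γ ⟨h1, h2⟩
      refine ((Nat.find_eq_iff hex).2 ⟨(hVγ n γ).1 ⟨_, h1, rfl⟩, fun k hk hxk => h2 ?_⟩).symm
      exact Set.mem_iUnion₂.2 ⟨k, hk, (hVγ k γ).2 hxk⟩
    refine ⟨⟨x⁻¹ * w, hxw⟩, ?_, fun γ hγ => ?_⟩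
    · simp only [mul_inv_cancel_left]
      refine Set.mem_iUnion.2 ⟨Nat.find hex, hw, fun h => ?_⟩
      obtain ⟨k, hk, hwk⟩ := Set.mem_iUnion₂.1 h
      refine Nat.find_min hex hk ?_
      simpa only [V, Set.mem_preimage, hwx] using hwk
    · obtain ⟨n, hnγ⟩ := Set.mem_iUnion.1 hγ
      have := hn n γ hnγ
      subst this
      have h3 : (g (Nat.find hex))⁻¹ * w = (g (Nat.find hex))⁻¹ * (x * γ) := by
        refine hinj _ hw _ hnγ.1 ?_
        have : w⁻¹ * x * γ ∈ Γ := Γ.mul_mem (by simpa using Γ.inv_mem hxw) γ.2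
        simpa [mul_assoc] using this
      refine Subtype.ext ?_
      change (γ : G) = x⁻¹ * w
      rw [mul_left_cancel h3, inv_mul_cancel_left]
  · refine ⟨⋃ h ∈ Set.range g, (fun x => h * x) '' Q,
      (hSfin hc).isCompact_biUnion fun h _ => hQ.image (by fun_prop), ?_⟩
    refine Set.iUnion_subset fun n x hx => ?_
    exact Set.mem_iUnion₂.2 ⟨g n, ⟨n, rfl⟩, (g n)⁻¹ * x, hUQ hx.1, by simp⟩

/-- A Borel fundamental domain is the image of a Borel section of the coset map. -/
lemma IsBorelFundamentalDomain.exists_section {D : Set G} (hD : IsBorelFundamentalDomain Γ D) :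
    ∃ s : G ⧸ Γ → G, Measurable s ∧ (∀ x, s x ∈ D) ∧
      (∀ x, (QuotientGroup.mk (s x) : G ⧸ Γ) = x) ∧
      ∀ y ∈ D, s (QuotientGroup.mk y) = y := by
  have hDm : MeasurableSet D := by
    rw [BorelSpace.measurable_eq (α := G)]; exact hD.borel
  have hex : ∀ x : G ⧸ Γ, ∃ y ∈ D, (QuotientGroup.mk y : G ⧸ Γ) = x := fun x => by
    obtain ⟨z, rfl⟩ := QuotientGroup.mk_surjective x
    obtain ⟨γ, hγ, -⟩ := hD.existsUnique z
    exact ⟨_, hγ, QuotientGroup.mk_mul_of_mem z γ.2⟩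
  choose s hsD hs using hex
  have huniq : ∀ y ∈ D, ∀ z ∈ D, (QuotientGroup.mk y : G ⧸ Γ) = QuotientGroup.mk z → y = z := by
    intro y hy z hz hyz
    have := (hD.existsUnique y).unique (y₁ := 1) (y₂ := ⟨y⁻¹ * z, QuotientGroup.eq.1 hyz⟩)
      (by simpa using hy) (by simpa using hz)
    rw [Subtype.ext_iff] at this
    exact inv_mul_eq_one.1 this.symm
  refine ⟨s, fun E hE => ?_, hsD, hs, fun y hy => huniq _ (hsD _) _ hy (hs _)⟩
  have : s ⁻¹' E = QuotientGroup.mk '' (E ∩ D) := by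
    ext x
    constructor
    · exact fun hx => ⟨s x, ⟨hx, hsD x⟩, hs x⟩
    · rintro ⟨y, ⟨hyE, hyD⟩, rfl⟩
      rwa [Set.mem_preimage, huniq _ (hsD _) _ hyD (hs _)]
  rw [this]
  exact measurableSet_image_mk (hE.inter hDm)

end FundamentalDomain

/-! ### Unfolding the invariant measure of $G/\Gamma$ to $G$. -/

section Haar

variable {G : Type*} [Group G] [TopologicalSpace G] [IsTopologicalGroup G] [T2Space G]
  [LocallyCompactSpace G] [SigmaCompactSpace G] [MeasurableSpace G] [BorelSpace G]

/-- Uniqueness of Haar measure on relatively compact sets passes to the limit along a compact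
covering, so no regularity of the measures is required. -/
lemma eq_smul_haar_of_sigmaCompact (ν' ν : Measure G) [ν.IsHaarMeasure]
    [IsFiniteMeasureOnCompacts ν'] [ν'.IsMulLeftInvariant] :
    ν' = Measure.haarScalarFactor ν' ν • ν := by
  ext s hs
  have hU : s = ⋃ n, s ∩ compactCovering G n := by
    rw [← Set.inter_iUnion, iUnion_compactCovering, Set.inter_univ]
  have hmono : Monotone fun n => s ∩ compactCovering G n := fun a b hab =>
    Set.inter_subset_inter_right _ (compactCovering_subset G hab)
  rw [hU, hmono.measure_iUnion, hmono.measure_iUnion]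
  refine iSup_congr fun n => ?_
  rw [Measure.measure_isMulInvariant_eq_smul_of_isCompact_closure ν' ν
    ((isCompact_compactCovering G n).closure_of_subset Set.inter_subset_right)]
  rfl

variable {Γ : Subgroup G} [DiscreteTopology Γ]

/-- The invariant measure on `G / Γ` unfolds to a regular Haar measure on `G`. -/
lemma exists_haar_unfolding {μ : Measure (G ⧸ Γ)} (hμ : IsInvariantProbability Γ μ) :
    ∃ ν : Measure G, ν.IsHaarMeasure ∧ ν.Regular ∧
      (∀ γ ∈ Γ, Measure.map (fun x => x * γ) ν = ν) ∧
      ∀ D : Set G, IsBorelFundamentalDomain Γ D →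
        Measure.map (QuotientGroup.mk : G → G ⧸ Γ) (ν.restrict D) = μ := by
  have := hμ.prob
  have := hμ.invariant
  have := countable_of_discrete_sigmaCompact Γ
  obtain ⟨D₀, hD₀, -⟩ := exists_isBorelFundamentalDomain Γ
  obtain ⟨s, hsm, -, hs, -⟩ := hD₀.exists_section
  have hsγ : ∀ γ : Γ, Measurable fun x => s x * (γ : G) := fun γ => hsm.mul_const _
  let ν : Measure G := Measure.sum fun γ : Γ => μ.map fun x => s x * (γ : G)
  -- The number of points of $E$ in the coset $x$, independent of the section by `hΘ`; $\nu(E)$ is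
  -- its integral.
  let Θ : Set G → G ⧸ Γ → ℝ≥0∞ := fun E x => ∑' γ : Γ, E.indicator 1 (s x * (γ : G))
  have hΘ : ∀ E (y : G), ∑' γ : Γ, E.indicator (1 : G → ℝ≥0∞) (y * (γ : G))
      = Θ E (QuotientGroup.mk y) := fun E y => by
    have hmem : (s (QuotientGroup.mk y))⁻¹ * y ∈ Γ := QuotientGroup.eq.1 (hs _)
    change _ = ∑' γ : Γ, E.indicator (1 : G → ℝ≥0∞) (s (QuotientGroup.mk y) * (γ : G))
    rw [← Equiv.tsum_eq (Equiv.mulLeft (⟨_, hmem⟩ : Γ))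
      fun γ : Γ => E.indicator (1 : G → ℝ≥0∞) (s (QuotientGroup.mk y) * (γ : G))]
    simp [mul_assoc]
  have hΘm : ∀ E, MeasurableSet E → ∀ γ : Γ,
      Measurable fun x => E.indicator (1 : G → ℝ≥0∞) (s x * (γ : G)) := fun E hE γ =>
    (measurable_one.indicator hE).comp (hsγ γ)
  have hν : ∀ E, MeasurableSet E → ν E = ∫⁻ x, Θ E x ∂μ := fun E hE => by
    rw [Measure.sum_apply _ hE, lintegral_tsum fun γ => (hΘm E hE γ).aemeasurable]
    refine tsum_congr fun γ => ?_
    rw [Measure.map_apply (hsγ γ) hE, ← lintegral_indicator_one (hsγ γ hE)]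
    rfl
  have hpre : ∀ (f : G → G) (E : Set G) (z : G),
      (f ⁻¹' E).indicator (1 : G → ℝ≥0∞) z = E.indicator 1 (f z) := fun _ _ _ => by
    classical
    rw [Set.indicator_apply, Set.indicator_apply]
    exact if_congr Set.mem_preimage rfl rfl
  have hleft : ν.IsMulLeftInvariant := ⟨fun g => by
    ext E hE
    rw [Measure.map_apply (measurable_const_mul g) hE, hν _ (measurable_const_mul g hE), hν E hE]
    have h1 : ∀ x, Θ ((fun y => g * y) ⁻¹' E) x = Θ E (g • x) := fun x => by
      obtain ⟨y, rfl⟩ := QuotientGroup.mk_surjective x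
      rw [← hΘ, MulAction.Quotient.smul_coe, ← hΘ]
      refine tsum_congr fun γ => ?_
      rw [hpre, smul_eq_mul, mul_assoc]
    simp only [h1]
    exact (measurePreserving_smul g μ).lintegral_comp_emb (measurableEmbedding_const_smul g) (Θ E)⟩
  have hright : ∀ γ ∈ Γ, Measure.map (fun x => x * γ) ν = ν := fun γ hγ => by
    ext E hE
    rw [Measure.map_apply (measurable_mul_const γ) hE, hν _ (measurable_mul_const γ hE), hν E hE]
    refine lintegral_congr fun x => ?_
    change ∑' γ' : Γ, _ = ∑' γ' : Γ, _
    rw [← Equiv.tsum_eq (Equiv.mulRight (⟨γ, hγ⟩ : Γ))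
      fun γ' : Γ => E.indicator (1 : G → ℝ≥0∞) (s x * (γ' : G))]
    refine tsum_congr fun γ' => ?_
    rw [hpre, Equiv.coe_mulRight, Subgroup.coe_mul, mul_assoc]
  have hfin : IsFiniteMeasureOnCompacts ν := ⟨fun K hK => by
    have hclosed : IsClosed (Γ : Set G) := Subgroup.isClosed_of_discrete
    -- A coset meets $K$ in at most $|\Gamma\cap K^{-1}K|$ points, which is finite.
    let L : Set G := (fun a : G × G => a.1⁻¹ * a.2) '' (K ×ˢ K)
    have hL : IsCompact L := (hK.prod hK).image (by fun_prop)
    have hF : ((Subtype.val : Γ → G) ⁻¹' L).Finite :=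
      (hclosed.isClosedEmbedding_subtypeVal.isCompact_preimage hL).finite_of_discrete
    rw [hν K hK.measurableSet]
    have hbound : ∀ x, Θ K x ≤ hF.toFinset.card := fun x => by
      by_cases hx : ∃ y ∈ K, (QuotientGroup.mk y : G ⧸ Γ) = x
      · obtain ⟨y, hy, rfl⟩ := hx
        rw [← hΘ]
        rw [tsum_eq_sum (s := hF.toFinset) fun γ hγ => ?_]
        · calc _ ≤ ∑ _γ ∈ hF.toFinset, (1 : ℝ≥0∞) := Finset.sum_le_sum fun γ _ =>
                Set.indicator_le_self' (fun _ _ => zero_le_one) _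
            _ = _ := by simp
        · refine Set.indicator_of_notMem (fun h => hγ ?_) _
          rw [Set.Finite.mem_toFinset]
          exact ⟨(y, y * γ), ⟨hy, h⟩, by simp⟩
      · have : Θ K x = 0 := by
          refine ENNReal.tsum_eq_zero.2 fun γ => Set.indicator_of_notMem (fun h => hx ?_) _
          exact ⟨_, h, (QuotientGroup.mk_mul_of_mem _ γ.2).trans (hs x)⟩
        rw [this]; exact zero_le
    calc ∫⁻ x, Θ K x ∂μ ≤ ∫⁻ _, (hF.toFinset.card : ℝ≥0∞) ∂μ := lintegral_mono hbound
      _ < ∞ := by simp⟩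
  have hdom : ∀ D : Set G, IsBorelFundamentalDomain Γ D →
      Measure.map (QuotientGroup.mk : G → G ⧸ Γ) (ν.restrict D) = μ := fun D hD => by
    have hDm : MeasurableSet D := by
      rw [BorelSpace.measurable_eq (α := G)]; exact hD.borel
    have hmk : Measurable (QuotientGroup.mk : G → G ⧸ Γ) := QuotientGroup.continuous_mk.measurable
    ext B hB
    rw [Measure.map_apply hmk hB, Measure.restrict_apply (hmk hB), hν _ ((hmk hB).inter hDm),
      ← lintegral_indicator_one hB]
    refine lintegral_congr fun x => ?_
    obtain ⟨γ, hγ, huniq⟩ := hD.existsUnique (s x)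
    change ∑' γ : Γ, _ = _
    rw [tsum_eq_single γ fun γ' hγ' => Set.indicator_of_notMem (fun h => hγ' (huniq _ h.2)) _]
    have hx : (QuotientGroup.mk (s x * γ) : G ⧸ Γ) = x :=
      (QuotientGroup.mk_mul_of_mem _ γ.2).trans (hs x)
    by_cases hxB : x ∈ B
    · rw [Set.indicator_of_mem hxB, Set.indicator_of_mem]
      · rfl
      · exact ⟨by rwa [Set.mem_preimage, hx], hγ⟩
    · rw [Set.indicator_of_notMem hxB,
        Set.indicator_of_notMem fun h => hxB (by have := h.1; rwa [Set.mem_preimage, hx] at this)]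
  have hc := eq_smul_haar_of_sigmaCompact ν Measure.haar
  set c := Measure.haarScalarFactor ν Measure.haar
  have hc0 : c ≠ 0 := fun h => by
    have h1 := hdom D₀ hD₀
    rw [hc, h] at h1
    have : μ Set.univ = 1 := measure_univ
    rw [← h1] at this
    simp at this
  refine ⟨ν, ?_, ?_, hright, hdom⟩
  · rw [hc]; exact Measure.IsHaarMeasure.nnreal_smul _ hc0
  · rw [hc]; exact Measure.Regular.smul_nnreal c

end Haar

/-! ### Measures invariant under a normal subgroup and a lattice. -/

section Invariance

variable {G : Type*} [Group G] [TopologicalSpace G] [IsTopologicalGroup G] [T2Space G]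
  [LocallyCompactSpace G] [MeasurableSpace G] [BorelSpace G]

/-- Testing against $\kappa\cdot(f_1-f_2)$ yields $\int\kappa(f_1-f_2)^2=0$ for a bump $\kappa$. -/
lemma eq_of_forall_integral_mul_eq {X : Type*} [TopologicalSpace X] [T2Space X]
    [LocallyCompactSpace X] [MeasurableSpace X] [BorelSpace X] {ν : Measure X}
    [ν.IsOpenPosMeasure] [IsFiniteMeasureOnCompacts ν] {f₁ f₂ : X → ℝ} (h₁ : Continuous f₁)
    (h₂ : Continuous f₂)
    (h : ∀ κ : X → ℝ, Continuous κ → HasCompactSupport κ →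
      ∫ x, κ x * f₁ x ∂ν = ∫ x, κ x * f₂ x ∂ν) : f₁ = f₂ := by
  funext x
  by_contra hx
  obtain ⟨κ, hκ, hκ0, hκx⟩ := exists_continuous_nonneg_pos x
  set d : X → ℝ := fun y => f₁ y - f₂ y with hd
  have hdc : Continuous d := h₁.sub h₂
  have hκd : Continuous fun y => κ y * d y := κ.continuous.mul hdc
  have hκds : HasCompactSupport fun y => κ y * d y := hκ.mul_right
  have h0 := h _ hκd hκds
  have hi : ∀ f : X → ℝ, Continuous f → Integrable (fun y => κ y * d y * f y) ν := fun f hf =>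
    (hκd.mul hf).integrable_of_hasCompactSupport hκds.mul_right
  rw [← sub_eq_zero, ← integral_sub (hi _ h₁) (hi _ h₂)] at h0
  have hpos := Continuous.integral_pos_of_hasCompactSupport_nonneg_nonzero (μ := ν) (x := x)
    (f := fun y => κ y * d y * f₁ y - κ y * d y * f₂ y)
    ((hκd.mul h₁).sub (hκd.mul h₂)) (hκds.mul_right.sub hκds.mul_right) (fun y => by
      have : κ y * d y * f₁ y - κ y * d y * f₂ y = κ y * (d y * d y) := by simp only [hd]; ring
      simp only [Pi.zero_apply]
      rw [this]
      exact mul_nonneg (hκ0 y) (mul_self_nonneg _)) (by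
      have : κ x * d x * f₁ x - κ x * d x * f₂ x = κ x * (d x * d x) := by simp only [hd]; ring
      rw [this]
      exact mul_ne_zero hκx (mul_self_ne_zero.2 (sub_ne_zero.2 hx)))
  exact hpos.ne' h0

lemma hasCompactSupport_mul_comp {X Y A B : Type*} [TopologicalSpace X] [TopologicalSpace Y]
    [TopologicalSpace A] [TopologicalSpace B] [T2Space A] [T2Space B] (e : A × B ≃ₜ X × Y)
    {κ : X → ℝ} {ξ : Y → ℝ} (hκ : HasCompactSupport κ) (hξ : HasCompactSupport ξ) :
    HasCompactSupport fun z => κ (e z).1 * ξ (e z).2 := by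
  refine HasCompactSupport.intro ((hκ.isCompact.prod hξ.isCompact).image e.symm.continuous)
    fun z hz => ?_
  by_contra hne
  obtain ⟨h1, h2⟩ := mul_ne_zero_iff.1 hne
  exact hz ⟨e z, ⟨subset_tsupport _ h1, subset_tsupport _ h2⟩, e.symm_apply_apply z⟩

/-- Fubini, left invariance of $\nu$, and Fubini again. The homeomorphisms show that both integrands
have compact support on $G\times G$, so no $\sigma$-finiteness is needed. -/
lemma integral_mul_integral_swap {ν σ : Measure G} [ν.IsMulLeftInvariant]
    [IsFiniteMeasureOnCompacts ν] [IsFiniteMeasureOnCompacts σ] {κ ξ : G → ℝ} (hκ : Continuous κ)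
    (hκs : HasCompactSupport κ) (hξ : Continuous ξ) (hξs : HasCompactSupport ξ) :
    ∫ x, κ x * ∫ g, ξ (g * x) ∂σ ∂ν = ∫ x, ξ x * ∫ g, κ (g⁻¹ * x) ∂σ ∂ν := by
  let e₁ : G × G ≃ₜ G × G :=
    { toFun := fun z => (z.1, z.2 * z.1)
      invFun := fun z => (z.1, z.2 * z.1⁻¹)
      left_inv := fun z => by simp
      right_inv := fun z => by simp
      continuous_toFun := by fun_prop
      continuous_invFun := by fun_prop }
  let e₂ : G × G ≃ₜ G × G :=
    { toFun := fun z => (z.1⁻¹ * z.2, z.2)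
      invFun := fun z => (z.2 * z.1⁻¹, z.2)
      left_inv := fun z => by simp
      right_inv := fun z => by simp
      continuous_toFun := by fun_prop
      continuous_invFun := by fun_prop }
  simp only [← integral_const_mul]
  rw [integral_integral_swap_of_hasCompactSupport (f := fun x g => κ x * ξ (g * x))
    (by simp only [Function.uncurry_def]; fun_prop)
    (hasCompactSupport_mul_comp e₁ hκs hξs)]
  have : ∀ g, ∫ x, κ x * ξ (g * x) ∂ν = ∫ x, ξ x * κ (g⁻¹ * x) ∂ν := fun g => by
    rw [← integral_mul_left_eq_self _ g⁻¹]
    simp [mul_comm]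
  simp only [this]
  refine integral_integral_swap_of_hasCompactSupport (f := fun g x => ξ x * κ (g⁻¹ * x))
    (by simp only [Function.uncurry_def]; fun_prop) ?_
  have := hasCompactSupport_mul_comp e₂ hκs hξs
  refine (congrArg HasCompactSupport ?_).mp this
  funext z
  exact mul_comm _ _

lemma continuous_integral_apply_mul {σ : Measure G} [IsFiniteMeasureOnCompacts σ] {ξ : G → ℝ}
    (hξ : Continuous ξ) (hξs : HasCompactSupport ξ) : Continuous fun x => ∫ g, ξ (g * x) ∂σ := by
  have h := continuous_integral_apply_inv_mul (μ := σ.inv) hξ hξs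
  have : ∀ x, ∫ y, ξ (y⁻¹ * x) ∂σ.inv = ∫ g, ξ (g * x) ∂σ := fun x => by
    refine ((Homeomorph.inv G).measurableEmbedding.integral_map _).trans ?_
    simp
  simpa only [this] using h

/-- A measure that is left invariant under a normal subgroup `N` and right invariant under a
subgroup `Γ` with `Γ N` dense is proportional to Haar measure, if the latter is bi-invariant. -/
lemma exists_integral_eq_mul_of_dense {ν σ : Measure G} [ν.IsHaarMeasure] [ν.IsMulRightInvariant]
    [IsFiniteMeasureOnCompacts σ] {N Γ : Subgroup G} [N.Normal]
    (hN : ∀ n ∈ N, Measure.map (fun x => n * x) σ = σ)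
    (hΓ : ∀ γ ∈ Γ, Measure.map (fun x => x * γ) σ = σ)
    (hdense : Dense {x : G | ∃ γ ∈ Γ, ∃ n ∈ N, γ * n = x}) :
    ∃ c : ℝ, ∀ ξ : G → ℝ, Continuous ξ → HasCompactSupport ξ →
      ∫ x, ξ x ∂σ = c * ∫ x, ξ x ∂ν := by
  have hNi : ∀ n ∈ N, ∀ f : G → ℝ, ∫ x, f (n * x) ∂σ = ∫ x, f x ∂σ := fun n hn f => by
    conv_rhs => rw [← hN n hn]
    exact ((Homeomorph.mulLeft n).measurableEmbedding.integral_map f).symm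
  have hΓi : ∀ γ ∈ Γ, ∀ f : G → ℝ, ∫ x, f (x * γ) ∂σ = ∫ x, f x ∂σ := fun γ hγ f => by
    conv_rhs => rw [← hΓ γ hγ]
    exact ((Homeomorph.mulRight γ).measurableEmbedding.integral_map f).symm
  have htr : ∀ (ξ : G → ℝ) (y : G), HasCompactSupport ξ → HasCompactSupport fun x => ξ (x * y) :=
    fun ξ y h => h.comp_homeomorph (Homeomorph.mulRight y)
  have hconst : ∀ ξ : G → ℝ, Continuous ξ → HasCompactSupport ξ → ∀ x,
      ∫ g, ξ (g * x) ∂σ = ∫ g, ξ g ∂σ := by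
    intro ξ hξ hξs
    -- $\Psi$ is left invariant under $\Gamma$ and right invariant under $N$, hence constant on the
    -- dense set $\Gamma N$ and so everywhere.
    set Ψ : G → ℝ := fun x => ∫ g, ξ (g * x) ∂σ with hΨ
    have hΨc : Continuous Ψ := continuous_integral_apply_mul hξ hξs
    have hright : ∀ n ∈ N, (fun x => Ψ (x * n)) = Ψ := by
      intro n hn
      refine eq_of_forall_integral_mul_eq (ν := ν) (hΨc.comp (continuous_mul_const n)) hΨc
        fun κ hκ hκs => ?_
      simp only [hΨ]
      have h1 := integral_mul_integral_swap (ν := ν) (σ := σ) hκ hκs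
        (hξ.comp (continuous_mul_const n)) (htr ξ n hξs)
      simp only [Function.comp_def, mul_assoc] at h1
      rw [h1, integral_mul_integral_swap hκ hκs hξ hξs,
        ← integral_mul_right_eq_self (fun x => ξ x * ∫ g, κ (g⁻¹ * x) ∂σ) n]
      refine integral_congr_ae (ae_of_all _ fun x => ?_)
      simp only []
      congr 1
      -- Normality turns right into left translation, $xn=(xnx^{-1})x$, which the left
      -- $N$-invariance of $\sigma$ absorbs.
      have hn' : (x * n * x⁻¹)⁻¹ ∈ N := N.inv_mem (Subgroup.Normal.conj_mem inferInstance n hn x)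
      rw [← hNi _ (N.inv_mem hn') fun g => κ (g⁻¹ * (x * n))]
      refine integral_congr_ae (ae_of_all _ fun g => ?_)
      simp only []
      congr 1
      group
    have hleft : ∀ γ ∈ Γ, ∀ x, Ψ (γ * x) = Ψ x := fun γ hγ x => by
      simp only [hΨ]
      rw [← hΓi γ hγ fun g => ξ (g * x)]
      simp only [mul_assoc]
    have hone : ∫ g, ξ g ∂σ = Ψ 1 := by simp [hΨ]
    have hclosed : IsClosed {x | Ψ x = Ψ 1} := isClosed_eq hΨc continuous_const
    have hsub : {x : G | ∃ γ ∈ Γ, ∃ n ∈ N, γ * n = x} ⊆ {x | Ψ x = Ψ 1} := by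
      rintro _ ⟨γ, hγ, n, hn, rfl⟩
      have := congrFun (hright n hn) 1
      simp only [one_mul] at this
      change Ψ (γ * n) = Ψ 1
      rw [hleft γ hγ, this]
    intro x
    rw [hone]
    have : x ∈ closure {x : G | ∃ γ ∈ Γ, ∃ n ∈ N, γ * n = x} := hdense x
    exact closure_minimal hsub hclosed this
  obtain ⟨κ, hκs, hκ0, hκ1⟩ := exists_continuous_nonneg_pos (1 : G)
  have hκ := κ.continuous
  have hI : 0 < ∫ x, κ x ∂ν :=
    hκ.integral_pos_of_hasCompactSupport_nonneg_nonzero hκs hκ0 hκ1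
  set f : G → ℝ := fun x => ∫ g, κ (g⁻¹ * x) ∂σ with hf
  have hfc : Continuous f := continuous_integral_apply_inv_mul hκ hκs
  -- With $\sigma$ now right invariant on test functions, this is the classical uniqueness argument:
  -- it exhibits $f$ as a density of $\sigma$ up to the factor $\nu(\kappa)$, and right invariance
  -- makes $f$ constant.
  have key : ∀ ξ : G → ℝ, Continuous ξ → HasCompactSupport ξ →
      ∫ x, ξ x * f x ∂ν = (∫ x, ξ x ∂σ) * ∫ x, κ x ∂ν := fun ξ hξ hξs => by
    rw [← integral_mul_integral_swap hκ hκs hξ hξs]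
    simp only [hconst ξ hξ hξs]
    rw [integral_mul_const, mul_comm]
  have hfconst : ∀ y, f y = f 1 := fun y => by
    have : (fun x => f (x * y⁻¹)) = f := by
      refine eq_of_forall_integral_mul_eq (ν := ν) (hfc.comp (continuous_mul_const y⁻¹)) hfc
        fun ξ hξ hξs => ?_
      rw [key ξ hξ hξs, ← hconst ξ hξ hξs y,
        ← key (fun x => ξ (x * y)) (hξ.comp (continuous_mul_const y)) (htr ξ y hξs),
        ← integral_mul_right_eq_self (fun x => ξ x * f (x * y⁻¹)) y]
      simp
    have := congrFun this y
    simpa using this.symm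
  refine ⟨f 1 / ∫ x, κ x ∂ν, fun ξ hξ hξs => ?_⟩
  have := key ξ hξ hξs
  simp only [hfconst] at this
  rw [integral_mul_const] at this
  field_simp
  linarith

/-- A bounded measurable function is determined up to null sets by its integrals against
compactly supported continuous functions. -/
lemma ae_eq_zero_of_forall_integral_mul_eq_zero [SigmaCompactSpace G] {ν : Measure G} [ν.Regular]
    {d : G → ℝ} (hd : Measurable d) {B : ℝ} (hB : ∀ x, |d x| ≤ B)
    (h : ∀ ξ : G → ℝ, Continuous ξ → HasCompactSupport ξ → ∫ x, ξ x * d x ∂ν = 0) :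
    d =ᵐ[ν] 0 := by
  have hB0 : 0 ≤ B := (abs_nonneg _).trans (hB 1)
  have hloc : LocallyIntegrable d ν :=
    (locallyIntegrable_const B).mono hd.aestronglyMeasurable
      (ae_of_all _ fun x => (hB x).trans (le_abs_self B))
  refine ae_eq_zero_of_forall_setIntegral_isCompact_eq_zero' hloc fun K hK => ?_
  rw [← abs_nonpos_iff]
  refine le_of_forall_pos_le_add fun ε hε => ?_
  rw [zero_add]
  obtain ⟨U, hKU, hU, hUε⟩ := hK.exists_isOpen_lt_add (μ := ν)
    (ε := ENNReal.ofReal (ε / (B + 1))) (by simpa using by positivity)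
  obtain ⟨ξ, hξK, hξs, hξU, hξ01⟩ := exists_continuousMap_one_of_isCompact_subset_isOpen hK hU hKU
  have hKm : MeasurableSet K := hK.measurableSet
  have hUK : ν (U \ K) ≤ ENNReal.ofReal (ε / (B + 1)) := by
    rw [measure_sdiff hKU hKm.nullMeasurableSet hK.measure_lt_top.ne]
    exact tsub_le_iff_left.2 hUε.le
  have hξi : Integrable (fun x => ξ x * d x) ν := by
    refine (ξ.continuous.integrable_of_hasCompactSupport hξs).mul_bdd (c := B)
      hd.aestronglyMeasurable (ae_of_all _ fun x => hB x)
  have hKi : Integrable (K.indicator d) ν :=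
    (integrable_indicator_iff hKm).2 (hloc.integrableOn_isCompact hK)
  have hbd : ∀ x, ‖K.indicator d x - ξ x * d x‖ ≤ (U \ K).indicator (fun _ => B) x := fun x => by
    by_cases hxK : x ∈ K
    · rw [Set.indicator_of_mem hxK, hξK hxK]
      simp [hxK]
    · rw [Set.indicator_of_notMem hxK]
      by_cases hxU : x ∈ U
      · rw [Set.indicator_of_mem (show x ∈ U \ K from ⟨hxU, hxK⟩), zero_sub, norm_neg, norm_mul]
        calc ‖ξ x‖ * ‖d x‖ ≤ 1 * B := by
              refine mul_le_mul ?_ (hB x) (norm_nonneg _) zero_le_one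
              rw [Real.norm_of_nonneg (hξ01 x).1]
              exact (hξ01 x).2
          _ = B := one_mul B
      · have : ξ x = 0 := image_eq_zero_of_notMem_tsupport fun hx => hxU (hξU hx)
        simp [this, hxU]
  have hUm : MeasurableSet (U \ K) := hU.measurableSet.diff hKm
  calc |∫ x in K, d x ∂ν| = ‖∫ x, (K.indicator d x - ξ x * d x) ∂ν‖ := by
        rw [integral_sub hKi hξi, h ξ ξ.continuous hξs, sub_zero, integral_indicator hKm]
        rfl
    _ ≤ ∫ x, (U \ K).indicator (fun _ => B) x ∂ν :=
        norm_integral_le_of_norm_le ((integrable_indicator_iff hUm).2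
          (integrableOn_const (hUK.trans_lt ENNReal.ofReal_lt_top).ne)) (ae_of_all _ hbd)
    _ = (ν (U \ K)).toReal * B := by
        rw [integral_indicator hUm]; simp [Measure.real]
    _ ≤ ε / (B + 1) * B := by
        gcongr
        exact ENNReal.toReal_le_of_le_ofReal (by positivity) hUK
    _ ≤ ε := by
        rw [div_mul_eq_mul_div, div_le_iff₀ (by positivity)]
        nlinarith

end Invariance

/-! ### Unimodularity. -/

section Lattice

variable {G : Type*} [Group G] [TopologicalSpace G] [IsTopologicalGroup G] [T2Space G]
  [LocallyCompactSpace G] [SigmaCompactSpace G] [MeasurableSpace G] [BorelSpace G]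
  {Γ : Subgroup G} [DiscreteTopology Γ]

/-- A group containing a lattice is unimodular. -/
lemma isMulRightInvariant_of_isInvariantProbability {μ : Measure (G ⧸ Γ)}
    (hμ : IsInvariantProbability Γ μ) {ν : Measure G} [ν.IsHaarMeasure]
    (hΓ : ∀ γ ∈ Γ, Measure.map (fun x => x * γ) ν = ν) : ν.IsMulRightInvariant := by
  have := hμ.prob
  have := hμ.invariant
  set Δ : G →* NNReal := Measure.modularCharacter with hΔ
  have hmap : ∀ y, Measure.map (fun x => x * y) ν = Δ y • ν := fun y => by
    have : Δ y = Measure.haarScalarFactor (Measure.map (fun x => x * y) ν) ν :=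
      Measure.modularCharacterFun_eq_haarScalarFactor ν y
    rw [this]
    exact eq_smul_haar_of_sigmaCompact _ _
  have hΔpos : ∀ y, 0 < Δ y := Measure.modularCharacterFun_pos
  have hΔΓ : ∀ γ ∈ Γ, Δ γ = 1 := fun γ hγ => by
    have : Δ γ = Measure.haarScalarFactor (Measure.map (fun x => x * γ) ν) ν :=
      Measure.modularCharacterFun_eq_haarScalarFactor ν γ
    simp only [this, hΓ γ hγ, Measure.haarScalarFactor_self]
  have hΔc : Continuous Δ := by
    obtain ⟨f, hfs, hf0, hf1⟩ := exists_continuous_nonneg_pos (1 : G)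
    have hI : ∫ x, f x ∂ν ≠ 0 :=
      (f.continuous.integral_pos_of_hasCompactSupport_nonneg_nonzero hfs hf0 hf1).ne'
    have h1 : ∀ y, (Δ y : ℝ) = (∫ x, f (x * y) ∂ν) / ∫ x, f x ∂ν := fun y => by
      have h2 : ∫ x, f (x * y) ∂ν = ∫ x, f x ∂(Δ y • ν) := by
        rw [← hmap y]
        exact ((Homeomorph.mulRight y).measurableEmbedding.integral_map f).symm
      rw [h2, integral_smul_nnreal_measure, NNReal.smul_def, smul_eq_mul, mul_div_assoc,
        div_self hI, mul_one]
    refine NNReal.isEmbedding_coe.continuous_iff.2 ?_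
    have : (NNReal.toReal ∘ Δ) = fun y => (∫ x, f (x * y) ∂ν) / ∫ x, f x ∂ν := funext h1
    rw [this]
    exact (continuous_integral_apply_mul f.continuous hfs).div_const _
  -- $\Delta$ is trivial on $\Gamma$ and descends to $F$ with $F(yx)=\Delta(y)F(x)$. If
  -- $\Delta(y)>1$, the sets $\{F<\Delta(y)^n\}$, $n\in\mathbf Z$, all have the same measure, yet
  -- increase to the whole space and decrease to $\varnothing$.
  let F : G ⧸ Γ → NNReal := Quotient.lift Δ fun a b hab => by
    have hab' : a⁻¹ * b ∈ Γ := QuotientGroup.leftRel_apply.1 hab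
    have := map_mul Δ a (a⁻¹ * b)
    rwa [hΔΓ _ hab', mul_one, mul_inv_cancel_left, eq_comm] at this
  have hF : ∀ y : G, F (QuotientGroup.mk y) = Δ y := fun y => rfl
  have hFc : Continuous F := hΔc.quotient_lift _
  have hFpos : ∀ x, 0 < F x := fun x => by
    obtain ⟨y, rfl⟩ := QuotientGroup.mk_surjective x
    exact hΔpos y
  have hFsmul : ∀ (y : G) x, F (y • x) = Δ y * F x := fun y x => by
    obtain ⟨z, rfl⟩ := QuotientGroup.mk_surjective x
    exact map_mul Δ y z
  have hmeas : ∀ a : NNReal, MeasurableSet {x | F x < a} := fun a =>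
    (isOpen_lt hFc continuous_const).measurableSet
  have hinv : ∀ (y : G) (a : NNReal), μ {x | F x < Δ y * a} = μ {x | F x < a} := fun y a => by
    rw [← measure_preimage_smul μ y {x | F x < Δ y * a}]
    congr 1
    ext x
    change F (y • x) < Δ y * a ↔ F x < a
    rw [hFsmul]
    exact mul_lt_mul_iff_right₀ (hΔpos y)
  have hle : ∀ y, Δ y ≤ 1 := by
    intro y
    by_contra! hy
    have hpow : ∀ n : ℕ, μ {x | F x < Δ y ^ n} = μ {x | F x < 1} := fun n => by
      have := hinv (y ^ n) 1
      rwa [map_pow, mul_one] at this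
    have hpow' : ∀ n : ℕ, μ {x | F x < (Δ y)⁻¹ ^ n} = μ {x | F x < 1} := fun n => by
      have := hinv (y ^ n) ((Δ y)⁻¹ ^ n)
      rw [map_pow, ← mul_pow, mul_inv_cancel₀ (hΔpos y).ne', one_pow] at this
      exact this.symm
    have hup : μ {x | F x < 1} = 1 := by
      have hmono : Monotone fun n : ℕ => {x | F x < Δ y ^ n} := fun m n hmn x hx =>
        lt_of_lt_of_le hx (pow_le_pow_right₀ hy.le hmn)
      have h1 := tendsto_measure_iUnion_atTop (μ := μ) hmono
      have h2 : ⋃ n : ℕ, {x | F x < Δ y ^ n} = Set.univ := by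
        refine Set.eq_univ_of_forall fun x => Set.mem_iUnion.2 ?_
        obtain ⟨n, hn⟩ := pow_unbounded_of_one_lt (F x) hy
        exact ⟨n, hn⟩
      rw [h2, measure_univ] at h1
      refine tendsto_nhds_unique ?_ h1
      simp only [Function.comp_def, hpow]
      exact tendsto_const_nhds
    have hdown : μ {x | F x < 1} = 0 := by
      have hanti : Antitone fun n : ℕ => {x | F x < (Δ y)⁻¹ ^ n} := fun m n hmn x hx =>
        lt_of_lt_of_le hx (pow_le_pow_of_le_one zero_le (inv_le_one_of_one_le₀ hy.le) hmn)
      have h1 := tendsto_measure_iInter_atTop (μ := μ)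
        (fun n : ℕ => (hmeas ((Δ y)⁻¹ ^ n)).nullMeasurableSet) hanti ⟨0, measure_ne_top _ _⟩
      have h2 : ⋂ n : ℕ, {x | F x < (Δ y)⁻¹ ^ n} = ∅ := by
        refine Set.eq_empty_of_forall_notMem fun x hx => ?_
        obtain ⟨n, hn⟩ := exists_pow_lt_of_lt_one (hFpos x) (inv_lt_one_of_one_lt₀ hy)
        exact absurd (Set.mem_iInter.1 hx n) (not_lt.2 hn.le)
      rw [h2, measure_empty] at h1
      refine tendsto_nhds_unique ?_ h1
      simp only [Function.comp_def, hpow']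
      exact tendsto_const_nhds
    rw [hup] at hdown
    exact one_ne_zero hdown
  refine ⟨fun y => ?_⟩
  have h1 : Δ y = 1 := by
    refine le_antisymm (hle y) ?_
    have h2 := hle y⁻¹
    have h3 : Δ y * Δ y⁻¹ = 1 := by rw [← map_mul, mul_inv_cancel, map_one]
    calc (1 : NNReal) = Δ y * Δ y⁻¹ := h3.symm
      _ ≤ Δ y * 1 := by gcongr
      _ = Δ y := mul_one _
  rw [hmap, h1, one_smul]

end Lattice

/-! ### Invariant functions viewed as densities of invariant measures. -/

/-- A bounded positive injective transform of a real function. -/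
def arctanDensity (t : ℝ) : NNReal := Real.toNNReal (Real.arctan t + 2)

lemma coe_arctanDensity (t : ℝ) : (arctanDensity t : ℝ) = Real.arctan t + 2 := by
  refine Real.coe_toNNReal _ ?_
  linarith [Real.neg_pi_div_two_lt_arctan t, Real.pi_lt_four]

lemma arctanDensity_le (t : ℝ) : arctanDensity t ≤ 4 := by
  rw [← NNReal.coe_le_coe, coe_arctanDensity]
  have := Real.arctan_lt_pi_div_two t
  have := Real.pi_lt_four
  norm_num
  linarith

lemma measurable_arctanDensity : Measurable arctanDensity :=
  (Real.measurable_arctan.add_const 2).real_toNNReal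

lemma arctanDensity_injective : Function.Injective arctanDensity := fun s t h => by
  have : (arctanDensity s : ℝ) = arctanDensity t := congrArg _ h
  rw [coe_arctanDensity, coe_arctanDensity, add_left_inj] at this
  exact Real.arctan_injective this

section Constant

variable {G : Type*} [Group G] [TopologicalSpace G] [IsTopologicalGroup G] [T2Space G]
  [LocallyCompactSpace G] [MeasurableSpace G] [BorelSpace G]

lemma isFiniteMeasureOnCompacts_withDensity_arctan (ν : Measure G) [IsFiniteMeasureOnCompacts ν]
    {w : G → ℝ} : IsFiniteMeasureOnCompacts
      (ν.withDensity fun x => (arctanDensity (w x) : ℝ≥0∞)) := ⟨fun K hK => by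
  rw [withDensity_apply _ hK.measurableSet]
  calc ∫⁻ x in K, (arctanDensity (w x) : ℝ≥0∞) ∂ν ≤ ∫⁻ _ in K, ((4 : NNReal) : ℝ≥0∞) ∂ν :=
        lintegral_mono fun x => ENNReal.coe_le_coe.2 (arctanDensity_le _)
    _ = 4 * ν K := by simp
    _ < ∞ := ENNReal.mul_lt_top (by simp) hK.measure_lt_top⟩

lemma map_withDensity_eq {X : Type*} [MeasurableSpace X] (ν : Measure X) (e : X ≃ᵐ X)
    (he : Measure.map e ν = ν) {F : X → ℝ≥0∞} (hF : Measurable F)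
    (h : ∀ᵐ x ∂ν, F (e x) = F x) : Measure.map e (ν.withDensity F) = ν.withDensity F := by
  ext E hE
  rw [Measure.map_apply e.measurable hE, withDensity_apply _ hE,
    withDensity_apply _ (e.measurable hE)]
  conv_rhs => rw [← he]
  rw [setLIntegral_map hE hF e.measurable]
  exact setLIntegral_congr_fun_ae (e.measurable hE) (h.mono fun x hx _ => hx.symm)

/-- A measurable function on a group that is almost everywhere invariant under each left
translation is constant almost everywhere. -/
lemma exists_ae_eq_const_of_left_invariant [SigmaCompactSpace G] (ν : Measure G) [ν.IsHaarMeasure]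
    {w : G → ℝ} (hw : Measurable w) (h : ∀ g, ∀ᵐ x ∂ν, w (g * x) = w x) :
    ∃ c, ∀ᵐ x ∂ν, w x = c := by
  let F : G → ℝ≥0∞ := fun x => (arctanDensity (w x) : ℝ≥0∞)
  have hF : Measurable F := (measurable_arctanDensity.comp hw).coe_nnreal_ennreal
  have := isFiniteMeasureOnCompacts_withDensity_arctan ν (w := w)
  have hleft : (ν.withDensity F).IsMulLeftInvariant := ⟨fun g =>
    map_withDensity_eq ν (MeasurableEquiv.mulLeft g) (map_mul_left_eq_self ν g) hF
      ((h g).mono fun x hx => by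
        change F (g * x) = F x
        simp only [F, hx])⟩
  -- Boundedness of the transform makes the density measure finite on compact sets, so Haar
  -- uniqueness applies; its injectivity recovers `w` from the density.
  have h1 := eq_smul_haar_of_sigmaCompact (ν.withDensity F) ν
  set c := Measure.haarScalarFactor (ν.withDensity F) ν
  have h2 : c • ν = ν.withDensity fun _ => (c : ℝ≥0∞) := by
    rw [withDensity_const]; rfl
  rw [h2, withDensity_eq_iff_of_sigmaFinite hF.aemeasurable aemeasurable_const] at h1
  have hne : (ae ν).NeBot := inferInstance
  obtain ⟨x₀, hx₀⟩ := h1.exists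
  refine ⟨w x₀, h1.mono fun x hx => ?_⟩
  exact arctanDensity_injective (ENNReal.coe_injective (hx.trans hx₀.symm))

end Constant

/-! ### Ergodicity of a normal subgroup $N$ with $\Gamma N$ dense. -/

section Ergodicity

variable {G : Type*} [Group G] [TopologicalSpace G] [IsTopologicalGroup G] [T2Space G]
  [LocallyCompactSpace G] [SigmaCompactSpace G]
  {Γ : Subgroup G} [DiscreteTopology Γ] {μ : Measure (G ⧸ Γ)}

/-- The preimage of a null set is covered by countably many $\Gamma$-translates of its part in $D$,
which is null. -/
lemma ae_mk_of_ae [MeasurableSpace G] [BorelSpace G] {ν : Measure G} {D : Set G}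
    (hD : IsBorelFundamentalDomain Γ D)
    (hΓ : ∀ γ ∈ Γ, Measure.map (fun x => x * γ) ν = ν)
    (hDμ : Measure.map (QuotientGroup.mk : G → G ⧸ Γ) (ν.restrict D) = μ) :
    Measure.QuasiMeasurePreserving (QuotientGroup.mk : G → G ⧸ Γ) ν μ := by
  have := countable_of_discrete_sigmaCompact Γ
  have hmk : Measurable (QuotientGroup.mk : G → G ⧸ Γ) := QuotientGroup.continuous_mk.measurable
  have hDm : MeasurableSet D := by
    rw [BorelSpace.measurable_eq (α := G)]; exact hD.borel
  refine ⟨hmk, Measure.AbsolutelyContinuous.mk fun B hB hB0 => ?_⟩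
  rw [Measure.map_apply hmk hB]
  rw [← hDμ, Measure.map_apply hmk hB, Measure.restrict_apply (hmk hB)] at hB0
  have hsub : QuotientGroup.mk ⁻¹' B ⊆
      ⋃ γ : Γ, (fun x => x * (γ : G)) ⁻¹' (QuotientGroup.mk ⁻¹' B ∩ D) := fun x hx => by
    obtain ⟨γ, hγ, -⟩ := hD.existsUnique x
    refine Set.mem_iUnion.2 ⟨γ, ?_, hγ⟩
    change (QuotientGroup.mk (x * (γ : G)) : G ⧸ Γ) ∈ B
    rw [QuotientGroup.mk_mul_of_mem x γ.2]
    exact hx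
  refine measure_mono_null hsub (measure_iUnion_null fun γ => ?_)
  rw [← Measure.map_apply (measurable_mul_const _) ((hmk hB).inter hDm), hΓ γ γ.2, hB0]

/-- A normal subgroup `N` with `Γ N` dense acts ergodically on `G / Γ`. -/
lemma exists_eq_const_of_translate_eq [MeasurableConstSMul G (G ⧸ Γ)]
    [SMulInvariantMeasure G (G ⧸ Γ) μ] [IsProbabilityMeasure μ]
    (hμ : IsInvariantProbability Γ μ) {N : Subgroup G} [N.Normal]
    (hdense : Dense {x : G | ∃ γ ∈ Γ, ∃ n ∈ N, γ * n = x})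
    (u : Lp ℝ 1 μ) (hu : ∀ n ∈ N, translate μ 1 n u = u) : ∃ c, u = Lp.const 1 μ c := by
  borelize G
  obtain ⟨ν, hν, hνr, hΓ, hdom⟩ := exists_haar_unfolding hμ
  have hright := isMulRightInvariant_of_isInvariantProbability hμ hΓ
  obtain ⟨D, hD, -⟩ := exists_isBorelFundamentalDomain Γ
  have hDμ := hdom D hD
  have hqmp := ae_mk_of_ae hD hΓ hDμ
  have hmk : Measurable (QuotientGroup.mk : G → G ⧸ Γ) := QuotientGroup.continuous_mk.measurable
  have hum : Measurable u := (Lp.stronglyMeasurable u).measurable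
  let w : G → ℝ := fun x => u (QuotientGroup.mk x)
  have hw : Measurable w := hum.comp hmk
  let F : G → ℝ≥0∞ := fun x => (arctanDensity (w x) : ℝ≥0∞)
  have hF : Measurable F := (measurable_arctanDensity.comp hw).coe_nnreal_ennreal
  have := isFiniteMeasureOnCompacts_withDensity_arctan ν (w := w)
  have hNσ : ∀ n ∈ N, Measure.map (fun x => n * x) (ν.withDensity F) = ν.withDensity F := by
    intro n hn
    refine map_withDensity_eq ν (MeasurableEquiv.mulLeft n) (map_mul_left_eq_self ν n) hF ?_
    have h1 := hu n⁻¹ (N.inv_mem hn)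
    have h2 := translate_ae_eq n⁻¹ u
    rw [h1] at h2
    filter_upwards [hqmp.ae h2] with x hx
    change F (n * x) = F x
    simp only [F, w]
    rw [hx, inv_inv]
    rfl
  have hΓσ : ∀ γ ∈ Γ, Measure.map (fun x => x * γ) (ν.withDensity F) = ν.withDensity F := by
    intro γ hγ
    refine map_withDensity_eq ν (MeasurableEquiv.mulRight γ) (hΓ γ hγ) hF (ae_of_all _ fun x => ?_)
    change F (x * γ) = F x
    simp only [F, w]
    rw [QuotientGroup.mk_mul_of_mem x hγ]
  -- The lift of `u` is $N$-invariant on the left and $\Gamma$-invariant on the right, so its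
  -- transform is the density of a multiple of Haar measure.
  obtain ⟨c, hc⟩ := exists_integral_eq_mul_of_dense (ν := ν) hNσ hΓσ hdense
  have hd : (fun x => (arctanDensity (w x) : ℝ) - c) =ᵐ[ν] 0 := by
    have hm : Measurable fun x => (arctanDensity (w x) : ℝ) :=
      (measurable_arctanDensity.comp hw).coe_nnreal_real
    refine ae_eq_zero_of_forall_integral_mul_eq_zero (hm.sub_const c) (B := 4 + |c|)
      (fun x => ?_) fun ξ hξ hξs => ?_
    · refine (abs_sub _ _).trans (add_le_add_left ?_ _)
      rw [NNReal.abs_eq]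
      exact_mod_cast arctanDensity_le (w x)
    · have h1 := hc ξ hξ hξs
      have h2 := integral_withDensity_eq_integral_smul (μ := ν)
        (measurable_arctanDensity.comp hw) ξ
      rw [show ∫ x, ξ x ∂ν.withDensity F = _ from h2] at h1
      have hi : Integrable ξ ν := hξ.integrable_of_hasCompactSupport hξs
      have hi2 : Integrable (fun x => ξ x * (arctanDensity (w x) : ℝ)) ν :=
        hi.mul_bdd (c := 4) hm.aestronglyMeasurable (ae_of_all _ fun x => by
          rw [Real.norm_eq_abs, NNReal.abs_eq]
          exact_mod_cast arctanDensity_le (w x))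
      simp only [mul_sub]
      rw [integral_sub hi2 (hi.mul_const c), integral_mul_const, sub_eq_zero, mul_comm _ c, ← h1]
      refine integral_congr_ae (ae_of_all _ fun x => ?_)
      simp [NNReal.smul_def, mul_comm]
  have hne : (ae ν).NeBot := inferInstance
  obtain ⟨x₀, hx₀⟩ := hd.exists
  refine ⟨w x₀, Lp.ext (Filter.EventuallyEq.trans ?_ (Lp.coeFn_const 1 μ (w x₀)).symm)⟩
  have hae : ∀ᵐ x ∂ν, w x = w x₀ := by
    filter_upwards [hd] with x hx
    refine arctanDensity_injective (NNReal.coe_injective ?_)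
    simp only [Pi.zero_apply, sub_eq_zero] at hx hx₀
    rw [hx, hx₀]
  have hset : MeasurableSet {x : G ⧸ Γ | u x = w x₀} := hum (measurableSet_singleton _)
  have : ∀ᵐ x ∂(Measure.map (QuotientGroup.mk : G → G ⧸ Γ) (ν.restrict D)), u x = w x₀ := by
    rw [ae_map_iff hmk.aemeasurable hset]
    exact ae_restrict_of_ae hae
  rwa [hDμ] at this

end Ergodicity

/-! ### From measurable cocycles to continuous $L^1$ cocycles. -/

section MeasurableCocycle

variable {G : Type*} [Group G] [TopologicalSpace G] [IsTopologicalGroup G]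
  {X : Type*} [MulAction G X] [MeasurableSpace X] [MeasurableConstSMul G X]
  {μ : Measure X} [SMulInvariantMeasure G X μ] {B : G → X → ℝ}

/-- $B(g')-B(g)$ is the $g$-translate of $B(g^{-1}g')$; this reduces continuity at $g$ to continuity
at the identity. -/
lemma measure_cocycle_ne (hB : ∀ g h x, B (g * h) x = B g x + B h (g⁻¹ • x)) (g g' : G) :
    μ {x | B g' x ≠ B g x} = μ {x | B (g⁻¹ * g') x ≠ 0} := by
  have h1 : {x | B g' x ≠ B g x} = (fun x : X => g⁻¹ • x) ⁻¹' {x | B (g⁻¹ * g') x ≠ 0} := by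
    ext x
    have := hB g (g⁻¹ * g') x
    rw [mul_inv_cancel_left] at this
    simp [this]
  rw [h1]
  exact (measurePreserving_smul g⁻¹ μ).measure_preimage_emb
    (measurableEmbedding_const_smul g⁻¹) _

lemma tendsto_measure_cocycle_ne (hB : ∀ g h x, B (g * h) x = B g x + B h (g⁻¹ • x))
    (hB0 : Filter.Tendsto (fun g => μ {x | B g x ≠ 0}) (𝓝 1) (𝓝 0)) (g : G) :
    Filter.Tendsto (fun g' => μ {x | B g' x ≠ B g x}) (𝓝 g) (𝓝 0) := by
  simp only [measure_cocycle_ne hB g]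
  have : Filter.Tendsto (fun g' => g⁻¹ * g') (𝓝 g) (𝓝 1) := by
    have h : Continuous fun g' : G => g⁻¹ * g' := by fun_prop
    simpa using h.tendsto g
  exact hB0.comp this

/-- Near $g$, $B(g')$ and $B(g)$ agree off a small set, on which the moment of $B(g)$ is small by
absolute continuity. -/
lemma isClosed_lintegral_cocycle_le (hBm : ∀ g, Measurable (B g))
    (hB : ∀ g h x, B (g * h) x = B g x + B h (g⁻¹ • x))
    (hB0 : Filter.Tendsto (fun g => μ {x | B g x ≠ 0}) (𝓝 1) (𝓝 0)) {p : ℝ}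
    (hBp : ∀ g, ∫⁻ x, ‖B g x‖ₑ ^ p ∂μ < ∞) (M : ℝ≥0∞) :
    IsClosed {g | ∫⁻ x, ‖B g x‖ₑ ^ p ∂μ ≤ M} := by
  refine isClosed_of_closure_subset fun g hg => ?_
  refine le_of_forall_pos_le_add (α := ℝ≥0∞) fun ε hε => ?_
  obtain ⟨δ, hδ, hδε⟩ := exists_pos_setLIntegral_lt_of_measure_lt (hBp g).ne hε.ne'
  have hev := (tendsto_measure_cocycle_ne hB hB0 g).eventually_lt_const hδ
  obtain ⟨g', hg', hM⟩ := (mem_closure_iff_frequently.1 hg).and_eventually hev |>.exists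
  have hS : MeasurableSet {x | B g' x ≠ B g x} :=
    (measurableSet_eq_fun (hBm g') (hBm g)).compl
  rw [← lintegral_add_compl _ hS, add_comm]
  refine add_le_add ?_ (hδε _ hM).le
  calc ∫⁻ x in {x | B g' x ≠ B g x}ᶜ, ‖B g x‖ₑ ^ p ∂μ
      = ∫⁻ x in {x | B g' x ≠ B g x}ᶜ, ‖B g' x‖ₑ ^ p ∂μ :=
        setLIntegral_congr_fun hS.compl fun x hx => by
          have : B g' x = B g x := not_not.1 hx
          simp only [this]
    _ ≤ _ := setLIntegral_le_lintegral _ _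
    _ ≤ M := hg'

/-- The `p`-th moments of a measurable cocycle with finite `p`-th moments are bounded on compact
sets: a Baire category argument. -/
lemma exists_lintegral_cocycle_le [BaireSpace G] (hBm : ∀ g, Measurable (B g))
    (hB : ∀ g h x, B (g * h) x = B g x + B h (g⁻¹ • x))
    (hB0 : Filter.Tendsto (fun g => μ {x | B g x ≠ 0}) (𝓝 1) (𝓝 0)) {p : ℝ} (hp : 1 < p)
    (hBp : ∀ g, ∫⁻ x, ‖B g x‖ₑ ^ p ∂μ < ∞) {C : Set G} (hC : IsCompact C) :
    ∃ M : NNReal, ∀ g ∈ C, ∫⁻ x, ‖B g x‖ₑ ^ p ∂μ ≤ M := by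
  let J : G → ℝ≥0∞ := fun g => ∫⁻ x, ‖B g x‖ₑ ^ p ∂μ
  have hJmul : ∀ g h, J (g * h) ≤ 2 ^ (p - 1) * (J g + J h) := fun g h => by
    have h1 : J h = ∫⁻ x, ‖B h (g⁻¹ • x)‖ₑ ^ p ∂μ :=
      ((measurePreserving_smul g⁻¹ μ).lintegral_comp_emb (measurableEmbedding_const_smul g⁻¹)
        (fun x => ‖B h x‖ₑ ^ p)).symm
    have hm : Measurable fun x => ‖B g x‖ₑ ^ p := (hBm g).enorm.pow_const p
    have hm' : Measurable fun x => ‖B h (g⁻¹ • x)‖ₑ ^ p :=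
      ((hBm h).comp (measurable_const_smul g⁻¹)).enorm.pow_const p
    rw [h1]
    simp only [J]
    rw [← lintegral_add_left hm, ← lintegral_const_mul (2 ^ (p - 1))
      (f := fun x => ‖B g x‖ₑ ^ p + ‖B h (g⁻¹ • x)‖ₑ ^ p) (hm.add hm')]
    refine lintegral_mono fun x => ?_
    rw [hB]
    exact (ENNReal.rpow_le_rpow (enorm_add_le _ _) (by linarith)).trans
      (ENNReal.rpow_add_le_mul_rpow_add_rpow _ _ hp.le)
  -- By Baire some sublevel set of $J$ has interior; finitely many translates of it cover `C`, and
  -- `hJmul` controls $J$ on each.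
  obtain ⟨M, u, hu⟩ := nonempty_interior_of_iUnion_of_closed
    (fun M : ℕ => isClosed_lintegral_cocycle_le hBm hB hB0 hBp (M : ℝ≥0∞))
    (Set.eq_univ_of_forall fun g => by
      obtain ⟨M, hM⟩ := ENNReal.exists_nat_gt (hBp g).ne
      exact Set.mem_iUnion.2 ⟨M, hM.le⟩)
  set U := interior {g | J g ≤ M}
  have hU : IsOpen U := isOpen_interior
  obtain ⟨t, ht⟩ := hC.elim_finite_subcover (fun c : G => (fun x => c⁻¹ * x) ⁻¹' U)
    (fun c => hU.preimage (by fun_prop))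
    (fun g _ => Set.mem_iUnion.2 ⟨g * u⁻¹, by simpa using hu⟩)
  have hfin : ∑ c ∈ t, 2 ^ (p - 1) * (J c + M) ≠ ∞ := by
    refine (ENNReal.sum_lt_top.2 fun c _ => ENNReal.mul_lt_top ?_ ?_).ne
    · exact ENNReal.rpow_lt_top_of_nonneg (by linarith) (by simp)
    · exact ENNReal.add_lt_top.2 ⟨hBp c, by simp⟩
  refine ⟨(∑ c ∈ t, 2 ^ (p - 1) * (J c + M)).toNNReal, fun g hg => ?_⟩
  rw [ENNReal.coe_toNNReal hfin]
  obtain ⟨c, hct, hc⟩ := Set.mem_iUnion₂.1 (ht hg)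
  have h1 : J (c⁻¹ * g) ≤ M := interior_subset (s := {g | J g ≤ M}) hc
  calc J g = J (c * (c⁻¹ * g)) := by rw [mul_inv_cancel_left]
    _ ≤ 2 ^ (p - 1) * (J c + J (c⁻¹ * g)) := hJmul _ _
    _ ≤ 2 ^ (p - 1) * (J c + M) := by gcongr
    _ ≤ _ := Finset.single_le_sum (f := fun c => 2 ^ (p - 1) * (J c + M))
      (fun _ _ => zero_le) hct

/-- A measurable cocycle with finite `p`-th moments, whose support shrinks at the identity, is a
continuous `L¹`-cocycle. -/
lemma exists_continuous_L1_cocycle [BaireSpace G] [WeaklyLocallyCompactSpace G]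
    [IsProbabilityMeasure μ]
    (hBm : ∀ g, Measurable (B g))
    (hB : ∀ g h x, B (g * h) x = B g x + B h (g⁻¹ • x))
    (hB0 : Filter.Tendsto (fun g => μ {x | B g x ≠ 0}) (𝓝 1) (𝓝 0)) {p : ℝ} (hp : 1 < p)
    (hBp : ∀ g, ∫⁻ x, ‖B g x‖ₑ ^ p ∂μ < ∞) :
    ∃ b : G → Lp ℝ 1 μ, (∀ g, b g =ᵐ[μ] B g) ∧
      (∀ g h, b (g * h) = b g + translate μ 1 g (b h)) ∧ Continuous b := by
  have hp0 : 0 < p := by linarith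
  have hmem : ∀ g, MemLp (B g) 1 μ := fun g => by
    have : MemLp (B g) (ENNReal.ofReal p) μ := by
      refine ⟨(hBm g).aestronglyMeasurable, ?_⟩
      rw [eLpNorm_lt_top_iff_lintegral_rpow_enorm_lt_top (by simpa using hp0) (by simp),
        ENNReal.toReal_ofReal hp0.le]
      exact hBp g
    exact this.mono_exponent (by simpa using hp.le)
  let b : G → Lp ℝ 1 μ := fun g => (hmem g).toLp
  have hbB : ∀ g, b g =ᵐ[μ] B g := fun g => (hmem g).coeFn_toLp
  have hcoc : ∀ g h, b (g * h) = b g + translate μ 1 g (b h) := fun g h => by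
    refine Lp.ext ?_
    filter_upwards [hbB (g * h), hbB g, Lp.coeFn_add (b g) (translate μ 1 g (b h)),
      translate_ae_eq g (b h),
      (measurePreserving_smul g⁻¹ μ).quasiMeasurePreserving.ae_eq_comp (hbB h)]
      with x h1 h2 h3 h4 h5
    rw [h1, h3, Pi.add_apply, h2, h4, hB]
    exact congrArg _ h5.symm
  refine ⟨b, hbB, hcoc, ?_⟩
  obtain ⟨C, hC, hC1⟩ := exists_compact_mem_nhds (1 : G)
  obtain ⟨M, hM⟩ := exists_lintegral_cocycle_le hBm hB hB0 hp hBp hC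
  obtain ⟨q, hpq⟩ : ∃ q, p.HolderConjugate q := ⟨_, Real.HolderConjugate.conjExponent hp⟩
  have hbound : ∀ g ∈ C, ‖b g‖ₑ ≤ (M : ℝ≥0∞) ^ (1 / p) * μ {x | B g x ≠ 0} ^ (1 / q) := by
    intro g hg
    have hS : MeasurableSet {x | B g x ≠ 0} :=
      (measurableSet_eq_fun (hBm g) measurable_const).compl
    have h1 : ‖b g‖ₑ = ∫⁻ x, ‖B g x‖ₑ ∂μ := by
      rw [Lp.enorm_def, eLpNorm_congr_ae (hbB g), eLpNorm_one_eq_lintegral_enorm]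
    have h2 : ∀ x, ‖B g x‖ₑ
        = ((fun x => ‖B g x‖ₑ) * {x | B g x ≠ 0}.indicator (1 : X → ℝ≥0∞)) x := fun x => by
      by_cases hx : B g x = 0 <;> simp [hx]
    have h3 : ∀ x, ({x | B g x ≠ 0}.indicator (1 : X → ℝ≥0∞) x) ^ q
        = {x | B g x ≠ 0}.indicator (1 : X → ℝ≥0∞) x := fun x => by
      by_cases hx : B g x = 0 <;> simp [hx, hpq.symm.pos]
    rw [h1, lintegral_congr h2]
    -- Hölder against the indicator of the support: bounded moments and shrinking supports force
    -- $\|b(g)\|_1\to0$ at the identity.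
    refine (ENNReal.lintegral_mul_le_Lp_mul_Lq μ hpq (hBm g).enorm.aemeasurable
      (measurable_one.indicator hS).aemeasurable).trans ?_
    rw [lintegral_congr h3, lintegral_indicator_one hS]
    gcongr
    exact hM g hg
  have hlim : Filter.Tendsto (fun g => ‖b g‖ₑ) (𝓝 1) (𝓝 0) := by
    have h1 : Filter.Tendsto (fun g => (M : ℝ≥0∞) ^ (1 / p) * μ {x | B g x ≠ 0} ^ (1 / q))
        (𝓝 1) (𝓝 0) := by
      have hq : 0 < 1 / q := one_div_pos.2 hpq.symm.pos
      have h2 := hB0.ennrpow_const (1 / q)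
      rw [ENNReal.zero_rpow_of_pos hq] at h2
      have h3 := ENNReal.Tendsto.const_mul (a := (M : ℝ≥0∞) ^ (1 / p)) h2 (Or.inr
        (ENNReal.rpow_ne_top_of_nonneg (one_div_nonneg.2 hp0.le) (by simp)))
      rwa [mul_zero] at h3
    exact tendsto_of_tendsto_of_tendsto_of_le_of_le' tendsto_const_nhds h1
      (Filter.Eventually.of_forall fun _ => zero_le)
      (Filter.mem_of_superset hC1 hbound)
  refine continuous_iff_continuousAt.2 fun g => ?_
  rw [ContinuousAt, tendsto_iff_edist_tendsto_0]
  have h1 : ∀ g', edist (b g') (b g) = ‖b (g⁻¹ * g')‖ₑ := fun g' => by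
    have := hcoc g (g⁻¹ * g')
    rw [mul_inv_cancel_left] at this
    rw [edist_eq_enorm_sub, this, add_sub_cancel_left, ← ofReal_norm, norm_translate, ofReal_norm]
  simp only [h1]
  have : Filter.Tendsto (fun g' => g⁻¹ * g') (𝓝 g) (𝓝 1) := by
    have h : Continuous fun g' : G => g⁻¹ * g' := by fun_prop
    simpa using h.tendsto g
  exact hlim.comp this

end MeasurableCocycle

/-! ### Growth of characters and the equivariant extension $h=\varphi\circ\chi$. -/

lemma norm_toAdd_list_prod_le {Λ : Type*} [Group Λ] (φ : Λ →* Multiplicative ℝ) {S : Set Λ} {C : ℝ}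
    (hC : ∀ s ∈ S, ‖(φ s).toAdd‖ ≤ C) (l : List Λ) (hl : ∀ s ∈ l, s ∈ S ∨ s⁻¹ ∈ S) :
    ‖(φ l.prod).toAdd‖ ≤ C * l.length := by
  induction l with
  | nil => simp
  | cons a l ih =>
    rw [List.prod_cons, map_mul, toAdd_mul, List.length_cons, Nat.cast_succ, mul_add_one]
    refine (norm_add_le _ _).trans ?_
    rw [add_comm]
    refine add_le_add (ih fun s hs => hl s (List.mem_cons_of_mem _ hs)) ?_
    rcases hl a List.mem_cons_self with h | h
    · exact hC a h
    · have := hC _ h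
      rwa [map_inv, toAdd_inv, norm_neg] at this

/-- A real character of a finitely generated group grows at most linearly in the word length. -/
lemma exists_norm_toAdd_le_mul_wordLength {Λ : Type*} [Group Λ] (φ : Λ →* Multiplicative ℝ)
    {S : Set Λ} (hS : S.Finite) (hgen : Subgroup.closure S = ⊤) :
    ∃ C : NNReal, ∀ x, ‖(φ x).toAdd‖ₑ ≤ C * (wordLength S x : ℝ≥0∞) := by
  obtain ⟨C, hC⟩ := (hS.image fun s => ‖(φ s).toAdd‖).bddAbove
  refine ⟨C.toNNReal, fun x => ?_⟩
  have hne : {k | ∃ l : List Λ, l.length = k ∧ (∀ s ∈ l, s ∈ S ∨ s⁻¹ ∈ S) ∧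
      l.prod = x}.Nonempty := by
    have hx : x ∈ (Subgroup.closure S).toSubmonoid := by rw [hgen]; trivial
    rw [Subgroup.closure_toSubmonoid] at hx
    obtain ⟨l, hl, hx⟩ := Submonoid.exists_list_of_mem_closure hx
    exact ⟨_, l, rfl, hl, hx⟩
  obtain ⟨l, hlen, hl, hx⟩ := Nat.sInf_mem hne
  have h1 := norm_toAdd_list_prod_le φ (C := C.toNNReal) (fun s hs =>
    (hC ⟨s, hs, rfl⟩).trans (Real.le_coe_toNNReal C)) l hl
  rw [hx, hlen] at h1
  rw [← ofReal_norm]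
  refine (ENNReal.ofReal_le_ofReal h1).trans ?_
  rw [ENNReal.ofReal_mul (by positivity), ENNReal.ofReal_coe_nnreal, ENNReal.ofReal_natCast]
  rfl

section Extension

variable {G : Type*} [Group G] [TopologicalSpace G] [IsTopologicalGroup G] [T2Space G]
  [LocallyCompactSpace G] [SigmaCompactSpace G] [MeasurableSpace G] [BorelSpace G]
  {Γ : Subgroup G} [DiscreteTopology Γ]

/-- The fibres of $\chi$ are right translates of $D$, and $\Gamma$ is countable. -/
lemma measurable_toAdd_comp {D : Set G} (hD : IsBorelFundamentalDomain Γ D) {χ : G → Γ}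
    (hχD : χ ⁻¹' {1} = D) (hχ : ∀ (g : G) (γ : Γ), χ (g * (γ : G)⁻¹) = γ * χ g)
    (φ : Γ →* Multiplicative ℝ) : Measurable fun x => (φ (χ x)).toAdd := by
  have := countable_of_discrete_sigmaCompact Γ
  have hDm : MeasurableSet D := by
    rw [BorelSpace.measurable_eq (α := G)]; exact hD.borel
  let m : MeasurableSpace Γ := ⊤
  have h1 : Measurable χ := measurable_to_countable' fun γ => by
    have : χ ⁻¹' {γ} = (fun x => x * (γ : G)) ⁻¹' D := by
      ext x
      have := hχ x γ⁻¹
      rw [Subgroup.coe_inv, inv_inv] at this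
      rw [← hχD, Set.mem_preimage, Set.mem_preimage, Set.mem_preimage, Set.mem_singleton_iff,
        Set.mem_singleton_iff, this, inv_mul_eq_one, eq_comm]
    rw [this]
    exact measurable_mul_const _ hDm
  exact (measurable_from_top (f := fun γ : Γ => (φ γ).toAdd)).comp h1

/-- A character of a `p`-integrable lattice extends to a measurable function on the group that is
equivariant under the lattice, vanishes on a fundamental domain `D` and all of whose left
translates are `p`-integrable on `D`. -/
lemma IsPIntegrable.exists_equivariant {p : ℝ} (hp : 1 < p) (hint : IsPIntegrable Γ p)
    (φ : Γ →* Multiplicative ℝ) (ν : Measure G) [ν.IsHaarMeasure] :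
    ∃ (D : Set G) (h : G → ℝ), IsBorelFundamentalDomain Γ D ∧ Measurable h ∧
      (∀ x (γ : Γ), h (x * γ) = h x - (φ γ).toAdd) ∧ (∀ x ∈ D, h x = 0) ∧
      ∀ g, ∫⁻ x in D, ‖h (g⁻¹ * x)‖ₑ ^ p ∂ν < ∞ := by
  borelize G
  have hp0 : 0 ≤ p := by linarith
  have hequi : ∀ χ : G → Γ, (∀ (g : G) (γ : Γ), χ (g * (γ : G)⁻¹) = γ * χ g) →
      ∀ x (γ : Γ), (φ (χ (x * γ))).toAdd = (φ (χ x)).toAdd - (φ γ).toAdd := fun χ hχ x γ => by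
    have := hχ x γ⁻¹
    rw [Subgroup.coe_inv, inv_inv] at this
    rw [this, map_mul, map_inv, toAdd_mul, toAdd_inv]
    ring
  have hzero : ∀ (χ : G → Γ) (D : Set G), χ ⁻¹' {1} = D → ∀ x ∈ D, (φ (χ x)).toAdd = 0 := by
    rintro χ D rfl x hx
    rw [show χ x = 1 from hx, map_one, toAdd_one]
  rcases hint with hc | ⟨S, hS, hgen, D, χ, hD, -, hχD, hχ, hfin⟩
  · obtain ⟨D, hD, hDQ⟩ := exists_isBorelFundamentalDomain Γ
    obtain ⟨Q, hQ, hDQ⟩ := hDQ hc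
    choose χ hχmem hχuniq using fun x => hD.existsUnique x
    have hχ : ∀ (g : G) (γ : Γ), χ (g * (γ : G)⁻¹) = γ * χ g := fun g γ =>
      (hχuniq _ _ (by
        change g * (γ : G)⁻¹ * ((γ * χ g : Γ) : G) ∈ D
        rw [Subgroup.coe_mul, mul_assoc, inv_mul_cancel_left]
        exact hχmem g)).symm
    have hχD : χ ⁻¹' {1} = D := by
      ext x
      constructor
      · intro hx
        have := hχmem x
        rw [show χ x = 1 from hx] at this
        simpa using this
      · intro hx
        exact (hχuniq x 1 (by simpa using hx)).symm
    refine ⟨D, _, hD, measurable_toAdd_comp hD hχD hχ φ, hequi χ hχ, hzero χ D hχD, fun g => ?_⟩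
    -- For $x\in D\subseteq Q$ the value $\chi(g^{-1}x)$ lies in the finite set $\Gamma\cap
    -- Q^{-1}gQ$.
    let L : Set G := (fun a : G × G => a.1⁻¹ * (g * a.2)) '' (Q ×ˢ Q)
    have hL : IsCompact L := (hQ.prod hQ).image (by fun_prop)
    have hclosed : IsClosed (Γ : Set G) := Subgroup.isClosed_of_discrete
    have hF : ((Subtype.val : Γ → G) ⁻¹' L).Finite :=
      (hclosed.isClosedEmbedding_subtypeVal.isCompact_preimage hL).finite_of_discrete
    have hbound : ∀ x ∈ D, ‖(φ (χ (g⁻¹ * x))).toAdd‖ₑ ^ p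
        ≤ ∑ γ ∈ hF.toFinset, ‖(φ γ).toAdd‖ₑ ^ p := fun x hx => by
      refine Finset.single_le_sum (f := fun γ : Γ => ‖(φ γ).toAdd‖ₑ ^ p)
        (fun _ _ => zero_le) ?_
      rw [Set.Finite.mem_toFinset]
      exact ⟨(x, g⁻¹ * x * χ (g⁻¹ * x)), ⟨hDQ hx, hDQ (hχmem _)⟩, by simp [mul_assoc]⟩
    have hDm : MeasurableSet D := hD.borel
    calc _ ≤ ∫⁻ _ in D, ∑ γ ∈ hF.toFinset, ‖(φ γ).toAdd‖ₑ ^ p ∂ν := setLIntegral_mono' hDm hbound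
      _ = (∑ γ ∈ hF.toFinset, ‖(φ γ).toAdd‖ₑ ^ p) * ν D := by rw [setLIntegral_const]
      _ < ∞ := ENNReal.mul_lt_top
        (ENNReal.sum_lt_top.2 fun _ _ => ENNReal.rpow_lt_top_of_nonneg hp0 (by simp))
        ((measure_mono hDQ).trans_lt hQ.measure_lt_top)
  · refine ⟨D, _, hD, measurable_toAdd_comp hD hχD hχ φ, hequi χ hχ, hzero χ D hχD, fun g => ?_⟩
    obtain ⟨C, hC⟩ := exists_norm_toAdd_le_mul_wordLength φ hS hgen
    rw [eq_smul_haar_of_sigmaCompact ν Measure.haar, Measure.restrict_smul, lintegral_smul_measure]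
    refine ENNReal.mul_lt_top (by simp) ?_
    calc _ ≤ ∫⁻ x in D, (C : ℝ≥0∞) ^ p * (wordLength S (χ (g⁻¹ * x)) : ℝ≥0∞) ^ p ∂Measure.haar := by
          refine lintegral_mono fun x => ?_
          rw [← ENNReal.mul_rpow_of_nonneg _ _ hp0]
          exact ENNReal.rpow_le_rpow (hC _) hp0
      _ = (C : ℝ≥0∞) ^ p * ∫⁻ x in D, (wordLength S (χ (g⁻¹ * x)) : ℝ≥0∞) ^ p ∂Measure.haar :=
          lintegral_const_mul' _ _ (ENNReal.rpow_ne_top_of_nonneg hp0 (by simp))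
      _ < ∞ := ENNReal.mul_lt_top (ENNReal.rpow_lt_top_of_nonneg hp0 (by simp)) (hfin g)

end Extension

/-! ### The induced cocycle. -/

section Induction

variable {G : Type*} [Group G] [TopologicalSpace G] [IsTopologicalGroup G] [T2Space G]
  [LocallyCompactSpace G] [SigmaCompactSpace G]
  {Γ : Subgroup G} [DiscreteTopology Γ] {μ : Measure (G ⧸ Γ)}

/-- The cocycle with values in `L¹(G / Γ)` induced by a character of a `p`-integrable lattice. If
it is, up to constants, a coboundary, then the character extends to the group. -/
theorem exists_induced_cocycle [SMulInvariantMeasure G (G ⧸ Γ) μ] [IsProbabilityMeasure μ]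
    (hμ : IsInvariantProbability Γ μ) {p : ℝ} (hp : 1 < p) (hint : IsPIntegrable Γ p)
    (φ : Γ →* Multiplicative ℝ) :
    ∃ b : G → Lp ℝ 1 μ, (∀ g h, b (g * h) = b g + translate μ 1 g (b h)) ∧ Continuous b ∧
      (∀ C, IsCompact C → ∃ M : NNReal, ∀ g ∈ C, ∫⁻ x, ‖b g x‖ₑ ^ p ∂μ ≤ M) ∧
      ((∃ v, ∀ g, b g = Lp.const 1 μ (∫ x, b g x ∂μ) + v - translate μ 1 g v) →
        ∀ γ : Γ, ∫ x, b γ x ∂μ = (φ γ).toAdd) := by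
  borelize G
  have := hμ.regular
  obtain ⟨ν, hν, hνr, hΓ, hdom⟩ := exists_haar_unfolding hμ
  obtain ⟨D, h, hD, hm, hγ, hD0, hfin⟩ := hint.exists_equivariant hp φ ν
  have hDm : MeasurableSet D := hD.borel
  have hDμ := hdom D hD
  have hqmp := ae_mk_of_ae hD hΓ hDμ
  have hmk : Measurable (QuotientGroup.mk : G → G ⧸ Γ) := QuotientGroup.continuous_mk.measurable
  obtain ⟨s, hsm, hsD, hs, hsy⟩ := hD.exists_section
  let B : G → G ⧸ Γ → ℝ := fun g x => h (g⁻¹ * s x)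
  have hBm : ∀ g, Measurable (B g) := fun g => hm.comp (hsm.const_mul g⁻¹)
  -- This form does not depend on the section; the cocycle identity becomes a telescoping sum.
  have hBmk : ∀ g y, B g (QuotientGroup.mk y) = h (g⁻¹ * y) - h y := fun g y => by
    have hmem : y⁻¹ * s (QuotientGroup.mk y) ∈ Γ := QuotientGroup.eq.1 (hs _).symm
    have h1 := hγ y ⟨_, hmem⟩
    have h2 := hγ (g⁻¹ * y) ⟨_, hmem⟩
    simp only [mul_assoc, mul_inv_cancel_left] at h1 h2
    rw [hD0 _ (hsD _)] at h1
    change h (g⁻¹ * s _) = _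
    rw [h2]
    linarith
  have hB : ∀ g k x, B (g * k) x = B g x + B k (g⁻¹ • x) := fun g k x => by
    obtain ⟨y, rfl⟩ := QuotientGroup.mk_surjective x
    rw [MulAction.Quotient.smul_coe, hBmk, hBmk, hBmk, smul_eq_mul, mul_inv_rev, mul_assoc]
    ring
  have hBν : ∀ g, ∀ y ∈ D, B g (QuotientGroup.mk y) = h (g⁻¹ * y) := fun g y hy => by
    rw [hBmk, hD0 y hy, sub_zero]
  have hBp : ∀ g, ∫⁻ x, ‖B g x‖ₑ ^ p ∂μ < ∞ := fun g => by
    rw [← hDμ, lintegral_map ((hBm g).enorm.pow_const p) hmk, setLIntegral_congr_fun hDm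
      (g := fun y => ‖h (g⁻¹ * y)‖ₑ ^ p) fun y hy => by simp only [hBν g y hy]]
    exact hfin g
  have hνD : ν D ≠ ∞ := by
    have h1 : μ Set.univ = 1 := measure_univ
    rw [← hDμ, Measure.map_apply hmk MeasurableSet.univ, Set.preimage_univ,
      Measure.restrict_apply_univ] at h1
    simp [h1]
  -- Since $h=0$ on $D$, the support of $B(g)$ is carried by $D\setminus gD$, whose measure tends to
  -- $0$ as $\nu(D)<\infty$.
  have hB0 : Filter.Tendsto (fun g => μ {x | B g x ≠ 0}) (𝓝 1) (𝓝 0) := by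
    let c : C(G, C(G, G)) :=
      (ContinuousMap.mk (fun a : G × G => a.1⁻¹ * a.2) (by fun_prop)).curry
    have h1 := tendsto_measure_symmDiff_preimage_nhds_zero (μ := ν) (c.continuous.tendsto 1)
      (Filter.Eventually.of_forall fun g => measurePreserving_mul_left ν g⁻¹)
      (measurePreserving_mul_left ν 1⁻¹) hDm.nullMeasurableSet hνD
    refine tendsto_of_tendsto_of_tendsto_of_le_of_le tendsto_const_nhds h1
      (fun _ => zero_le) fun g => ?_
    have hS : MeasurableSet {x | B g x ≠ 0} :=
      (measurableSet_eq_fun (hBm g) measurable_const).compl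
    change μ {x | B g x ≠ 0} ≤ _
    rw [← hDμ, Measure.map_apply hmk hS, Measure.restrict_apply (hmk hS)]
    refine measure_mono fun y hy => Or.inr ⟨?_, fun hy' => hy.1 ?_⟩
    · change (1 : G)⁻¹ * y ∈ D
      simpa using hy.2
    · rw [hBν g y hy.2]
      exact hD0 _ hy'
  obtain ⟨b, hbB, hcoc, hbc⟩ := exists_continuous_L1_cocycle hBm hB hB0 hp hBp
  refine ⟨b, hcoc, hbc, fun C hC => ?_, ?_⟩
  · obtain ⟨M, hM⟩ := exists_lintegral_cocycle_le hBm hB hB0 hp hBp hC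
    refine ⟨M, fun g hg => ?_⟩
    rw [lintegral_congr_ae ((hbB g).mono fun x hx => by rw [hx])]
    exact hM g hg
  · rintro ⟨v, hv⟩
    let ψ : G → ℝ := fun g => ∫ x, b g x ∂μ
    have hψ : ∀ g k, ψ (g * k) = ψ g + ψ k := fun g k => by
      change ∫ x, b (g * k) x ∂μ = _
      rw [hcoc, integral_add_Lp, integral_translate]
    have hψc : Continuous ψ := continuous_integral.comp hbc |>.congr fun g => rfl
    have hψ1 : ∀ g, ψ g⁻¹ = - ψ g := fun g => by
      have h1 := hψ g g⁻¹
      have h2 := hψ 1 1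
      rw [mul_inv_cancel] at h1
      rw [mul_one] at h2
      linarith
    have hvm : Measurable v := (Lp.stronglyMeasurable v).measurable
    -- Left translation by $g$ changes the three terms by amounts that cancel, by the coboundary
    -- equation at $g^{-1}$; right translation by $\gamma$ changes $w$ by
    -- $\psi(\gamma)-\varphi(\gamma)$.
    let w : G → ℝ := fun y => h y + v (QuotientGroup.mk y) + ψ y
    have hw : Measurable w := (hm.add (hvm.comp hmk)).add hψc.measurable
    have hinv : ∀ g, ∀ᵐ y ∂ν, w (g * y) = w y := fun g => by
      have h1 : ∀ᵐ x ∂μ, B g⁻¹ x = ψ g⁻¹ + v x - v (g • x) := by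
        have h2 := translate_ae_eq g⁻¹ v
        rw [inv_inv] at h2
        filter_upwards [hbB g⁻¹, h2, Lp.coeFn_const 1 μ (ψ g⁻¹),
          Lp.coeFn_add (Lp.const 1 μ (ψ g⁻¹)) v,
          Lp.coeFn_sub (Lp.const 1 μ (ψ g⁻¹) + v) (translate μ 1 g⁻¹ v)] with x k1 k2 k3 k4 k5
        rw [← k1, hv g⁻¹, k5, Pi.sub_apply, k4, Pi.add_apply, k3, k2]
        rfl
      filter_upwards [hqmp.ae h1] with y hy
      rw [hBmk, inv_inv, hψ1, MulAction.Quotient.smul_coe, smul_eq_mul] at hy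
      simp only [w, hψ]
      linarith
    obtain ⟨c, hc⟩ := exists_ae_eq_const_of_left_invariant ν hw hinv
    intro γ
    have hc' : ∀ᵐ y ∂ν, w (y * γ) = c := by
      have h1 : Measure.QuasiMeasurePreserving (fun y : G => y * (γ : G)) ν ν :=
        ⟨measurable_mul_const _, (hΓ γ γ.2).absolutelyContinuous⟩
      exact h1.ae hc
    have hne : (ae ν).NeBot := inferInstance
    obtain ⟨y, hy, hy'⟩ := (hc.and hc').exists
    simp only [w, hψ, hγ, QuotientGroup.mk_mul_of_mem y γ.2] at hy hy'
    change ψ γ = _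
    linarith

end Induction

end LatticeCharacters

end

/-! ### The extension theorem. -/

theorem mainTheorem6 {n : ℕ} (H : Fin n → Type*) [∀ i, Group (H i)]
    [∀ i, TopologicalSpace (H i)] [∀ i, IsTopologicalGroup (H i)] [∀ i, T2Space (H i)]
    [∀ i, LocallyCompactSpace (H i)] [SigmaCompactSpace (∀ i, H i)]
    (Γ : Subgroup (∀ i, H i))
    (hlat : LatticeCharacters.IsLattice Γ)
    (hirr : LatticeCharacters.IsIrreducible Γ)
    (hwc : LatticeCharacters.IsWeaklyCocompact Γ)
    (p : ℝ) (hp : 1 < p) (hint : LatticeCharacters.IsPIntegrable Γ p)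
    (φ : Γ →* Multiplicative ℝ) :
    ∃ ψ : (∀ i, H i) →* Multiplicative ℝ, Continuous ψ ∧ ∀ γ : Γ, ψ (γ : ∀ i, H i) = φ γ := by
  -- The empty product is the trivial group; the mean over the factors requires at least one factor.
  rcases Nat.eq_zero_or_pos n with rfl | hn
  · refine ⟨1, continuous_const, fun γ => ?_⟩
    rw [Subsingleton.elim γ 1, map_one, Subgroup.coe_one, map_one]
  have hne : Nonempty (Fin n) := ⟨⟨0, hn⟩⟩
  have hdisc := hlat.discrete
  have hσ : ∀ i, SigmaCompactSpace (H i) := fun i =>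
    isSigmaCompact_univ_iff.1 (by
      simpa [(Function.surjective_eval i).range_eq] using
        isSigmaCompact_univ.image (continuous_apply (A := H) i))
  let m : MeasurableSpace ((∀ i, H i) ⧸ Γ) := LatticeCharacters.cosetBorel Γ
  have hB : BorelSpace ((∀ i, H i) ⧸ Γ) := LatticeCharacters.cosetBorelSpace Γ
  obtain ⟨μ, hμ, hwc⟩ := hwc
  have := hμ.prob
  have := hμ.invariant
  have := hμ.regular
  obtain ⟨b, hcoc, hbc, hbp, hext⟩ := LatticeCharacters.exists_induced_cocycle hμ hp hint φ
  have herg : ∀ i (u : Lp ℝ 1 μ),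
      (∀ g : ∀ i, H i, g i = 1 → LatticeCharacters.translate μ 1 g u = u) → ∃ c, u = Lp.const 1 μ c := fun i u hu => by
    refine LatticeCharacters.exists_eq_const_of_translate_eq hμ
      (N := (Pi.evalMonoidHom H i).ker) ?_ u hu
    intro x
    rw [mem_closure_iff]
    intro O hO hx
    -- Density of $\Gamma N$ for $N$ the kernel of the $i$-th projection: pick $\gamma$ with
    -- $\gamma_i$ close to $x_i$. Replacing $x_i$ by $\gamma_i$ gives a point near $x$ that differs
    -- from $\gamma$ by an element of $N$.
    let e : H i → ∀ j, H j := Function.update x i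
    have he : Continuous e := continuous_const.update i continuous_id
    obtain ⟨_, ha, γ, hγ, rfl⟩ := (hirr i).inter_open_nonempty (e ⁻¹' O) (hO.preimage he)
      ⟨x i, by simpa [e] using hx⟩
    exact ⟨e (γ i), ha, γ, hγ, γ⁻¹ * e (γ i), by simp [MonoidHom.mem_ker, e], by simp⟩
  have hφ := hext (LatticeCharacters.exists_eq_const_add_sub_translate hwc herg hcoc hbc hp hbp)
  have hadd : ∀ g k, ∫ x, b (g * k) x ∂μ = ∫ x, b g x ∂μ + ∫ x, b k x ∂μ := fun g k => by
    rw [hcoc, LatticeCharacters.integral_add_Lp, LatticeCharacters.integral_translate]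
  refine ⟨MonoidHom.mk' (fun g => Multiplicative.ofAdd (∫ x, b g x ∂μ)) fun g k => ?_, ?_,
    fun γ => ?_⟩
  · rw [hadd, ofAdd_add]
  · exact continuous_ofAdd.comp (continuous_integral.comp hbc)
  · exact congrArg Multiplicative.ofAdd (hφ γ)
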